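/- For integers $d\ge 1$ and $D\ge 1$, a $(d,D,-2)$-graph is a finite simple graph of maximum degree $d$, diameter $D$ and order $$1+d\bigl(1+(d-1)+\cdots+(d-1)^{D-1}\bigr)-2 ,$$ that is, two less than the Moore bound. Let $\Theta_D$ denote the union of three pairwise internally disjoint paths of length $D$ with the same two end vertices. Let $d\ge 4$ and $D\ge 4$, and let $\Gamma$ be a $(d,D,-2)$-graph. Then: 1. $\Gamma$ contains no subgraph isomorphic to $\Theta_D$. 2. Every vertex $x$ of $\Gamma$ is contained in exactly two cycles of length $2D$, the intersection of these two cycles is a path of length $\ell$ for some $0\le \ell\le D-1$ (a path of length $0$ being a single vertex), and $x$ is contained in no other cycle of length at most $2D$. -/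

import Mathlib

/-- The Moore bound `1 + Δ (1 + (Δ-1) + ... + (Δ-1)^(D-1))`. -/
def mooreBound (Δ D : ℕ) : ℕ :=
  1 + Δ * ∑ i ∈ Finset.range D, (Δ - 1) ^ i

/-- `G` is a `(Δ, D, -ε)`-graph: a finite simple graph of maximum degree `Δ`, (finite) diameter `D`
and order `mooreBound Δ D - ε`. -/
structure IsDefectGraph {V : Type*} [Fintype V] (G : SimpleGraph V) [DecidableRel G.Adj]
    (Δ D ε : ℕ) : Prop where
  maxDegree_eq : G.maxDegree = Δ
  ediam_eq : G.ediam = (D : ℕ∞)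
  card_add : Fintype.card V + ε = mooreBound Δ D

namespace SimpleGraph.Subgraph

variable {V : Type*} {G : SimpleGraph V}

/-- The subgraph `H` is a path of length `k`. -/
def IsPathOfLength (H : G.Subgraph) (k : ℕ) : Prop :=
  ∃ (u v : V) (p : G.Walk u v), p.IsPath ∧ p.length = k ∧ H = p.toSubgraph

/-- The subgraph `H` is a cycle of length `k`. -/
def IsCycleOfLength (H : G.Subgraph) (k : ℕ) : Prop :=
  ∃ (u : V) (c : G.Walk u u), c.IsCycle ∧ c.length = k ∧ H = c.toSubgraph

/-- The subgraph `H` is a copy of `Θ_D`: the union of three distinct, pairwise internally disjoint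
paths of length `D` with the same two (distinct) ends `a` and `b`. -/
def IsTheta (H : G.Subgraph) (D : ℕ) : Prop :=
  ∃ (a b : V) (p : Fin 3 → G.Walk a b),
    a ≠ b ∧
    (∀ i, (p i).IsPath ∧ (p i).length = D) ∧
    (∀ i j, i ≠ j → p i ≠ p j ∧ ∀ v, v ∈ (p i).support → v ∈ (p j).support → v = a ∨ v = b) ∧
    H = ⨆ i, (p i).toSubgraph

end SimpleGraph.Subgraph

/-- The vertex `x` is of Type (iii) (with respect to `D`): it lies in two distinct `2D`-cycles whose
intersection is a path of length at most `D - 1`, and in no other cycle of length at most `2D`. -/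
def IsTypeThree {V : Type*} (G : SimpleGraph V) (D : ℕ) (x : V) : Prop :=
  ∃ C₁ C₂ : G.Subgraph,
    C₁ ≠ C₂ ∧
    C₁.IsCycleOfLength (2 * D) ∧ x ∈ C₁.verts ∧
    C₂.IsCycleOfLength (2 * D) ∧ x ∈ C₂.verts ∧
    (∃ l : ℕ, l ≤ D - 1 ∧ (C₁ ⊓ C₂).IsPathOfLength l) ∧
    ∀ (C : G.Subgraph) (k : ℕ),
      k ≤ 2 * D → C.IsCycleOfLength k → x ∈ C.verts → C = C₁ ∨ C = C₂

/-! Call a non-backtracking walk of length at most `D` short, and let b(x, y) be the number of short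
walks from x to y, minus one. The diameter gives b ≥ 0. A vertex of degree below `d` would cost too
many vertices, so the graph is regular, and counting walks shows that every row of b sums to the
defect 2. So each vertex either has two repeats (vertices y with b(x, y) > 0) joined to it by two
short walks each, or a single one joined to it by three. The recurrence for non-backtracking walks
makes b commute with the adjacency matrix: if y is a repeat of x, each neighbour of x has a repeat
adjacent to y. These facts form `RepeatLaws`, from which the rest follows.

As `d ≥ 4`, two different short walks with the same ends close up to length 2D - 1 or 2D; otherwise
some vertex would have three repeats (`exists_isCyclicSeq`). The odd length and the theta graph are
excluded by one argument. Either configuration uses up all the repeats of its vertices, so its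
vertex set S is saturated, and then no walk outside S closes up with a walk inside S to length at
most 2D (`no_excursion`). But an edge leaving S forces a 2D-cycle outside S, and the second repeats
of the vertices of that cycle trace a walk parallel to it which does close up with part of S
(`false_of_parallel`).

Hence every vertex has exactly two repeats, each the antipode on one 2D-cycle, and every cycle of
length at most 2D arises so. Uniqueness of shorter walks makes the intersection of the two cycles a
common segment; if that had length D or more there would be three short walks between two vertices.
-/

namespace SimpleGraph

/-! ### Non-backtracking walks. -/

namespace Walk

variable {V : Type*} {G : SimpleGraph V}

/-- The walk `p` does not backtrack, and its first step does not lead to `a`. -/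
def NBFrom : ∀ {x y : V}, V → G.Walk x y → Prop
  | _, _, _, nil => True
  | x, _, a, cons (v := z) _ p => z ≠ a ∧ NBFrom x p

/-- The walk `p` does not backtrack. -/
def NB : ∀ {x y : V}, G.Walk x y → Prop
  | _, _, nil => True
  | x, _, cons _ p => NBFrom x p

theorem nbFrom_cons {x y z a : V} (h : G.Adj x z) (p : G.Walk z y) :
    (cons h p).NBFrom a ↔ z ≠ a ∧ p.NBFrom x := Iff.rfl

theorem nb_cons {x y z : V} (h : G.Adj x z) (p : G.Walk z y) :
    (cons h p).NB ↔ p.NBFrom x := Iff.rfl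

theorem nb_nil {x : V} : (nil : G.Walk x x).NB := trivial

theorem nbFrom_iff {x y a : V} (p : G.Walk x y) :
    p.NBFrom a ↔ p.NB ∧ (0 < p.length → p.getVert 1 ≠ a) := by
  cases p with
  | nil => simp [NBFrom, NB]
  | cons h p => simp [nbFrom_cons, nb_cons, and_comm]

theorem nb_iff_getVert {x y : V} (p : G.Walk x y) :
    p.NB ↔ ∀ i, i + 2 ≤ p.length → p.getVert i ≠ p.getVert (i + 2) := by
  induction p with
  | nil => simp [NB]
  | @cons x z y h p ih =>
    rw [nb_cons, nbFrom_iff, ih]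
    constructor
    · rintro ⟨h1, h2⟩ i hi
      cases i with
      | zero => simpa using (h2 (by simp at hi; omega)).symm
      | succ i => simpa using h1 i (by simp at hi; omega)
    · intro H
      refine ⟨fun i hi => ?_, fun hp => ?_⟩
      · simpa using H (i + 1) (by simp; omega)
      · simpa using (H 0 (by simp; omega)).symm

theorem NB.reverse {x y : V} {p : G.Walk x y} (hp : p.NB) : p.reverse.NB := by
  rw [nb_iff_getVert] at *
  intro i hi
  rw [length_reverse] at hi
  rw [getVert_reverse, getVert_reverse]
  have := hp (p.length - (i + 2)) (by omega)
  rw [show p.length - (i + 2) + 2 = p.length - i by omega] at this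
  exact this.symm

theorem IsPath.nb {x y : V} {p : G.Walk x y} (hp : p.IsPath) : p.NB := by
  rw [nb_iff_getVert]
  intro i hi h
  have := hp.getVert_injOn (by simp; omega : i ∈ {i | i ≤ p.length}) (by simpa using hi) h
  omega

end Walk

/-! ### Counting non-backtracking walks. -/

section Counting

theorem sum_neighborSet {V : Type*} [Fintype V] (G : SimpleGraph V) [DecidableRel G.Adj] (x : V) (f : V → ℕ) :
    ∑ z : G.neighborSet x, f z.1 = ∑ z ∈ G.neighborFinset x, f z := by
  refine (Finset.sum_subtype _ (fun z => ?_) f).symm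
  simp

variable {V : Type*} [Fintype V] [DecidableEq V] (G : SimpleGraph V) [DecidableRel G.Adj]

open scoped Classical in
/-- The number of non-backtracking walks of length `k` from `x` to `y`. -/
noncomputable def nbCount (k : ℕ) (x y : V) : ℕ :=
  ((G.finsetWalkLength k x y).filter fun p => p.NB).card

open scoped Classical in
/-- The number of non-backtracking walks of length `k` from `x` to `y` whose first step does not
lead to `a`. -/
noncomputable def nbCountFrom (k : ℕ) (a x y : V) : ℕ :=
  ((G.finsetWalkLength k x y).filter fun p => p.NBFrom a).card

open scoped Classical in
theorem card_filter_finsetWalkLength_succ (k : ℕ) (x y : V) (P : G.Walk x y → Prop) :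
    ((G.finsetWalkLength (k + 1) x y).filter P).card =
      ∑ z : G.neighborSet x,
        ((G.finsetWalkLength k z.1 y).filter fun p => P (Walk.cons z.2 p)).card := by
  rw [finsetWalkLength, Finset.filter_biUnion, Finset.card_biUnion]
  · refine Finset.sum_congr rfl fun z _ => ?_
    rw [Finset.filter_map, Finset.card_map]
    rfl
  · intro z _ w _ hzw
    rw [Function.onFun, Finset.disjoint_left]
    intro p hp hq
    simp only [Finset.mem_filter, Finset.mem_map] at hp hq
    obtain ⟨⟨p', -, rfl⟩, -⟩ := hp
    obtain ⟨⟨q', -, hq⟩, -⟩ := hq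
    apply hzw
    injection hq with _ h1
    exact Subtype.ext h1.symm

theorem nbCount_succ (k : ℕ) (x y : V) :
    G.nbCount (k + 1) x y = ∑ z ∈ G.neighborFinset x, G.nbCountFrom k x z y := by
  rw [nbCount, card_filter_finsetWalkLength_succ, ← sum_neighborSet]
  rfl

theorem nbCountFrom_succ (k : ℕ) (a x y : V) :
    G.nbCountFrom (k + 1) a x y =
      ∑ z ∈ (G.neighborFinset x).erase a, G.nbCountFrom k x z y := by
  classical
  rw [nbCountFrom, card_filter_finsetWalkLength_succ]
  have : ∀ z : G.neighborSet x,
      ((G.finsetWalkLength k z.1 y).filter fun p => (Walk.cons z.2 p).NBFrom a).card =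
        if z.1 ≠ a then G.nbCountFrom k x z.1 y else 0 := by
    intro z
    have h1 : ∀ p : G.Walk z.1 y, (Walk.cons z.2 p).NBFrom a ↔ z.1 ≠ a ∧ p.NBFrom x :=
      fun p => Iff.rfl
    simp_rw [h1]
    split_ifs with h
    · simp only [ne_eq, h, not_false_eq_true, true_and]
      rfl
    · simp [h]
  rw [Finset.sum_congr rfl fun z _ => this z,
    G.sum_neighborSet x (fun z => if z ≠ a then G.nbCountFrom k x z y else 0),
    ← Finset.sum_filter]
  refine Finset.sum_congr ?_ fun _ _ => rfl
  ext z
  simp [and_comm]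

theorem nbCount_zero (x y : V) : G.nbCount 0 x y = if x = y then 1 else 0 := by
  classical
  rw [nbCount, finsetWalkLength]
  split_ifs with h
  · subst h
    simp [Walk.nb_nil, Finset.filter_singleton]
  · simp

theorem nbCountFrom_zero (a x y : V) : G.nbCountFrom 0 a x y = if x = y then 1 else 0 := by
  classical
  rw [nbCountFrom, finsetWalkLength]
  split_ifs with h
  · subst h
    simp [Walk.NBFrom, Finset.filter_singleton]
  · simp

theorem nbCount_comm (k : ℕ) (x y : V) : G.nbCount k x y = G.nbCount k y x := by
  classical
  rw [nbCount, nbCount]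
  refine Finset.card_bij' (fun p _ => p.reverse) (fun p _ => p.reverse) ?_ ?_ ?_ ?_
  · intro p hp
    simp only [Finset.mem_filter, mem_finsetWalkLength_iff] at hp ⊢
    exact ⟨by simp [hp.1], hp.2.reverse⟩
  · intro p hp
    simp only [Finset.mem_filter, mem_finsetWalkLength_iff] at hp ⊢
    exact ⟨by simp [hp.1], hp.2.reverse⟩
  · simp
  · simp

/-- Split by the first step: the walks that begin with a step to `a` continue from `a` without
returning to `x`. -/
theorem nbCountFrom_add {k : ℕ} {a x : V} (h : G.Adj x a) (y : V) :
    G.nbCountFrom (k + 1) a x y + G.nbCountFrom k x a y = G.nbCount (k + 1) x y := by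
  rw [nbCount_succ, nbCountFrom_succ, Finset.sum_erase_add]
  simpa using h

theorem sum_nbCountFrom_le {d : ℕ} (hd : ∀ x, G.degree x ≤ d) (k : ℕ) {a x : V}
    (h : G.Adj a x) : ∑ y, G.nbCountFrom k a x y ≤ (d - 1) ^ k := by
  induction k generalizing a x with
  | zero => simp [nbCountFrom_zero]
  | succ k ih =>
    simp_rw [nbCountFrom_succ]
    rw [Finset.sum_comm]
    refine (Finset.sum_le_card_nsmul _ _ ((d - 1) ^ k) fun z hz => ih ?_).trans ?_
    · simp at hz; exact hz.2
    · rw [Finset.card_erase_of_mem (by simpa using h.symm), card_neighborFinset_eq_degree,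
        smul_eq_mul, pow_succ']
      exact Nat.mul_le_mul_right _ (Nat.sub_le_sub_right (hd x) 1)

theorem sum_nbCountFrom_eq {d : ℕ} (hd : ∀ x, G.degree x = d) (k : ℕ) {a x : V}
    (h : G.Adj a x) : ∑ y, G.nbCountFrom k a x y = (d - 1) ^ k := by
  induction k generalizing a x with
  | zero => simp [nbCountFrom_zero]
  | succ k ih =>
    simp_rw [nbCountFrom_succ]
    rw [Finset.sum_comm, Finset.sum_congr rfl (g := fun _ => (d - 1) ^ k)]
    · rw [Finset.sum_const, Finset.card_erase_of_mem (by simpa using h.symm),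
        card_neighborFinset_eq_degree, smul_eq_mul, pow_succ', hd]
    · intro z hz
      simp at hz
      exact ih hz.2

/-- The number of non-backtracking walks of length at most `D` from `x` to `y`. -/
noncomputable def shortCount (D : ℕ) (x y : V) : ℕ :=
  ∑ k ∈ Finset.range (D + 1), G.nbCount k x y

/-- The degree of `x` is kept in the bound, so that a vertex of degree below `d` can be detected. -/
theorem sum_shortCount_le {d : ℕ} (hd : ∀ x, G.degree x ≤ d) (D : ℕ) (x : V) :
    ∑ y, G.shortCount D x y ≤ 1 + G.degree x * ∑ i ∈ Finset.range D, (d - 1) ^ i := by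
  simp_rw [shortCount]
  rw [Finset.sum_comm, Finset.sum_range_succ', add_comm, Finset.mul_sum]
  refine Nat.add_le_add (by simp [nbCount_zero]) (Finset.sum_le_sum fun k _ => ?_)
  simp_rw [nbCount_succ]
  rw [Finset.sum_comm]
  refine (Finset.sum_le_card_nsmul _ _ ((d - 1) ^ k) fun z hz => ?_).trans ?_
  · exact G.sum_nbCountFrom_le hd k (by simpa using hz)
  · simp

theorem sum_shortCount_eq {d : ℕ} (hd : ∀ x, G.degree x = d) (D : ℕ) (x : V) :
    ∑ y, G.shortCount D x y = mooreBound d D := by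
  simp_rw [shortCount, mooreBound]
  rw [Finset.sum_comm, Finset.sum_range_succ', add_comm, Finset.mul_sum]
  congr 1
  · simp [nbCount_zero]
  · refine Finset.sum_congr rfl fun k _ => ?_
    simp_rw [nbCount_succ]
    rw [Finset.sum_comm, Finset.sum_congr rfl (g := fun _ => (d - 1) ^ k)]
    · rw [Finset.sum_const, card_neighborFinset_eq_degree, smul_eq_mul, hd]
    · intro z hz
      exact G.sum_nbCountFrom_eq hd k (by simpa using hz)

/-- The non-backtracking counting matrices commute with the adjacency matrix. -/
theorem sum_nbCount_neighbor_comm {d : ℕ} (hd : ∀ x, G.degree x = d) (k : ℕ) (x y : V) :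
    ∑ z ∈ G.neighborFinset x, G.nbCount k z y = ∑ z ∈ G.neighborFinset y, G.nbCount k x z := by
  -- With N_k the counting matrices and A the adjacency matrix, this is A N_{k+1} = N_{k+2} + (d -
  -- 1) N_k, with d in place of d - 1 when k = 0. The right side is symmetric, hence so is the left,
  -- which is commutation.
  have key : ∀ k x y, ∑ z ∈ G.neighborFinset x, G.nbCount (k + 1) z y =
      G.nbCount (k + 2) x y +
        if k = 0 then (if x = y then d else 0) else (d - 1) * G.nbCount k x y := by
    intro k x y
    have h1 : ∀ z ∈ G.neighborFinset x, G.nbCount (k + 1) z y =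
        G.nbCountFrom (k + 1) x z y + G.nbCountFrom k z x y := by
      intro z hz
      rw [nbCountFrom_add]
      simpa [adj_comm] using hz
    rw [Finset.sum_congr rfl h1, Finset.sum_add_distrib, ← nbCount_succ]
    congr 1
    cases k with
    | zero => simp [nbCountFrom_zero, hd]
    | succ k =>
      simp only [Nat.add_eq_zero_iff, one_ne_zero, and_false, if_false]
      have h2 : ∀ z ∈ G.neighborFinset x,
          G.nbCountFrom (k + 1) z x y + G.nbCountFrom k x z y = G.nbCount (k + 1) x y := by
        intro z hz
        exact G.nbCountFrom_add (by simpa using hz) y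
      have h3 := Finset.sum_congr rfl h2
      rw [Finset.sum_add_distrib, ← nbCount_succ, Finset.sum_const,
        card_neighborFinset_eq_degree, hd, smul_eq_mul] at h3
      rw [Nat.sub_mul, one_mul]
      omega
  have h4 : ∑ z ∈ G.neighborFinset y, G.nbCount k x z =
      ∑ z ∈ G.neighborFinset y, G.nbCount k z x :=
    Finset.sum_congr rfl fun z _ => G.nbCount_comm k x z
  rw [h4]
  cases k with
  | zero => simp [nbCount_zero, adj_comm]
  | succ k => simp_rw [key, G.nbCount_comm (k + 2) x, G.nbCount_comm k x, eq_comm (a := x)]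

theorem sum_shortCount_neighbor_comm {d : ℕ} (hd : ∀ x, G.degree x = d) (D : ℕ) (x y : V) :
    ∑ z ∈ G.neighborFinset x, G.shortCount D z y =
      ∑ z ∈ G.neighborFinset y, G.shortCount D x z := by
  simp_rw [shortCount]
  rw [Finset.sum_comm, Finset.sum_comm (s := G.neighborFinset y)]
  exact Finset.sum_congr rfl fun k _ => G.sum_nbCount_neighbor_comm hd k x y

open scoped Classical in
/-- The non-backtracking walks of length at most `D` from `x` to `y`. -/
noncomputable def shortWalks (D : ℕ) (x y : V) : Finset (G.Walk x y) :=
  (Finset.range (D + 1)).biUnion fun k => (G.finsetWalkLength k x y).filter fun p => p.NB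

theorem mem_shortWalks {D : ℕ} {x y : V} {p : G.Walk x y} :
    p ∈ G.shortWalks D x y ↔ p.length ≤ D ∧ p.NB := by
  simp [shortWalks, mem_finsetWalkLength_iff]

theorem card_shortWalks (D : ℕ) (x y : V) :
    (G.shortWalks D x y).card = G.shortCount D x y := by
  classical
  rw [shortWalks, Finset.card_biUnion]
  · rfl
  · intro k _ l _ hkl
    rw [Function.onFun, Finset.disjoint_left]
    intro p hp hq
    simp only [Finset.mem_filter, mem_finsetWalkLength_iff] at hp hq
    exact hkl (hp.1.symm.trans hq.1)

end Counting

/-! ### Repeats and their laws. -/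

variable {V : Type*} (G : SimpleGraph V)

/-- `p` is a non-backtracking walk of length at most `D`. -/
def Walk.Short {G : SimpleGraph V} (D : ℕ) {x y : V} (p : G.Walk x y) : Prop :=
  p.length ≤ D ∧ p.NB

/-- `y` is a repeat of `x`: two different short walks lead from `x` to `y`. -/
def Repeat (D : ℕ) (x y : V) : Prop :=
  ∃ p q : G.Walk x y, p ≠ q ∧ p.Short D ∧ q.Short D

/-- The properties of repeats in a graph of defect two. -/
structure RepeatLaws (d D : ℕ) : Prop where
  exists_nbr : ∀ (x : V) (s : Finset V), s.card < d → ∃ z, G.Adj x z ∧ z ∉ s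
  not_three : ∀ x y₁ y₂ y₃, y₁ ≠ y₂ → y₁ ≠ y₃ → y₂ ≠ y₃ →
    G.Repeat D x y₁ → G.Repeat D x y₂ → ¬ G.Repeat D x y₃
  not_three_walks : ∀ x y₁ y₂, y₁ ≠ y₂ → G.Repeat D x y₂ → ∀ p q r : G.Walk x y₁,
    p.Short D → q.Short D → r.Short D → p ≠ q → p ≠ r → q ≠ r → False
  not_four_walks : ∀ x y, ∀ p q r s : G.Walk x y,
    p.Short D → q.Short D → r.Short D → s.Short D → p ≠ q → p ≠ r → q ≠ r →
    p ≠ s → q ≠ s → r ≠ s → False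
  transport : ∀ x x' y, G.Adj x x' → G.Repeat D x y → ∃ y', G.Adj y y' ∧ G.Repeat D x' y'
  exists_repeat : ∀ x, (∃ y z, y ≠ z ∧ G.Repeat D x y ∧ G.Repeat D x z) ∨
    ∃ y, ∃ p q r : G.Walk x y, p.Short D ∧ q.Short D ∧ r.Short D ∧ p ≠ q ∧ p ≠ r ∧ q ≠ r

variable {G}

theorem Repeat.symm {D : ℕ} {x y : V} (h : G.Repeat D x y) : G.Repeat D y x := by
  obtain ⟨p, q, hpq, hp, hq⟩ := h
  refine ⟨p.reverse, q.reverse, fun h => hpq ?_, ⟨by simpa using hp.1, hp.2.reverse⟩,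
    ⟨by simpa using hq.1, hq.2.reverse⟩⟩
  simpa using congrArg Walk.reverse h

theorem one_le_shortCount [Fintype V] [DecidableEq V] [DecidableRel G.Adj] {D : ℕ}
    (hD : G.ediam = (D : ℕ∞)) (x y : V) : 1 ≤ G.shortCount D x y := by
  have h1 : G.edist x y ≤ D := hD ▸ edist_le_ediam
  obtain ⟨p, hp⟩ := exists_walk_of_edist_ne_top (ne_top_of_le_ne_top (ENat.natCast_ne_top D) h1)
  rw [← hp] at h1
  have h2 : p.length ≤ D := by exact_mod_cast h1
  rw [← card_shortWalks, Nat.one_le_iff_ne_zero, Finset.card_ne_zero]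
  exact ⟨p.toPath, G.mem_shortWalks.2 ⟨(p.length_bypass_le_length).trans h2, p.toPath.2.nb⟩⟩

/-- Seen from a vertex of smaller degree, the walk count loses at least the geometric sum, which is
at least 3 and so exceeds the defect 2. -/
theorem degree_eq_of_isDefectGraph [Fintype V] [DecidableRel G.Adj] {d D : ℕ} (hd : 4 ≤ d)
    (hD : 4 ≤ D) (hG : IsDefectGraph G d D 2) (x : V) : G.degree x = d := by
  classical
  have hle : ∀ x, G.degree x ≤ d := fun x => hG.maxDegree_eq ▸ G.degree_le_maxDegree x
  by_contra hne
  have hlt : G.degree x + 1 ≤ d := lt_of_le_of_ne (hle x) hne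
  have h1 := G.sum_shortCount_le hle D x
  have h2 : Fintype.card V ≤ ∑ y, G.shortCount D x y := by
    simpa using Finset.card_nsmul_le_sum Finset.univ (fun y => G.shortCount D x y) 1
      fun y _ => one_le_shortCount hG.ediam_eq x y
  have h3 := hG.card_add
  rw [mooreBound] at h3
  set s := ∑ i ∈ Finset.range D, (d - 1) ^ i with hs
  have h4 : 3 ≤ s := by
    have : ∑ i ∈ Finset.range D, 1 ≤ s :=
      Finset.sum_le_sum fun i _ => Nat.one_le_pow _ _ (by omega)
    simp at this
    omega
  have h5 : (G.degree x + 1) * s ≤ d * s := Nat.mul_le_mul_right _ hlt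
  rw [add_mul, one_mul] at h5
  omega

theorem repeatLaws_of_isDefectGraph [Fintype V] [DecidableRel G.Adj] {d D : ℕ} (hd : 4 ≤ d)
    (hD : 4 ≤ D) (hG : IsDefectGraph G d D 2) : G.RepeatLaws d D := by
  classical
  have hdeg := degree_eq_of_isDefectGraph hd hD hG
  obtain ⟨b, hb⟩ : ∃ b : V → V → ℕ, ∀ x y, G.shortCount D x y = b x y + 1 :=
    ⟨fun x y => G.shortCount D x y - 1, fun x y => by
      have := one_le_shortCount hG.ediam_eq x y
      dsimp only
      omega⟩
  have hsum : ∀ x, ∑ y, b x y = 2 := by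
    intro x
    have h1 := G.sum_shortCount_eq hdeg D x
    simp_rw [hb, Finset.sum_add_distrib] at h1
    have h2 := hG.card_add
    simp at h1
    omega
  have hrep : ∀ x y, G.Repeat D x y ↔ 1 ≤ b x y := by
    intro x y
    have h1 : 1 ≤ b x y ↔ 1 < (G.shortWalks D x y).card := by
      rw [card_shortWalks, hb]; omega
    rw [h1, Finset.one_lt_card]
    simp only [mem_shortWalks]
    constructor
    · rintro ⟨p, q, h, hp, hq⟩
      exact ⟨p, hp, q, hq, h⟩
    · rintro ⟨p, hp, q, hq, h⟩
      exact ⟨p, q, h, hp, hq⟩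
  have hcard : ∀ x y (s : Finset (G.Walk x y)), (∀ p ∈ s, p.Short D) → s.card ≤ b x y + 1 := by
    intro x y s hs
    rw [← hb, ← card_shortWalks]
    exact Finset.card_le_card fun p hp => G.mem_shortWalks.2 (hs p hp)
  have hthree : ∀ x y (p q r : G.Walk x y), p.Short D → q.Short D → r.Short D → p ≠ q → p ≠ r →
      q ≠ r → 2 ≤ b x y := by
    intro x y p q r hp hq hr h1 h2 h3
    have := hcard x y {p, q, r} (by simp [hp, hq, hr])
    rw [Finset.card_eq_three.2 ⟨p, q, r, h1, h2, h3, rfl⟩] at this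
    omega
  have hle : ∀ x (s : Finset V), ∑ y ∈ s, b x y ≤ 2 := fun x s =>
    hsum x ▸ Finset.sum_le_sum_of_subset (Finset.subset_univ s)
  refine ⟨?_, ?_, ?_, ?_, ?_, ?_⟩
  · intro x s hs
    have : ¬ G.neighborFinset x ⊆ s := fun h => by
      have := Finset.card_le_card h
      rw [card_neighborFinset_eq_degree, hdeg] at this
      omega
    obtain ⟨z, hz, hzs⟩ := Finset.not_subset.1 this
    exact ⟨z, by simpa using hz, hzs⟩
  · intro x y₁ y₂ y₃ h1 h2 h3 r1 r2 r3
    rw [hrep] at r1 r2 r3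
    have := hle x {y₁, y₂, y₃}
    rw [Finset.sum_insert (by simp [h1, h2]), Finset.sum_pair h3] at this
    omega
  · intro x y₁ y₂ h12 r2 p q r hp hq hr h1 h2 h3
    have h4 := hthree x y₁ p q r hp hq hr h1 h2 h3
    rw [hrep] at r2
    have := hle x {y₁, y₂}
    rw [Finset.sum_pair h12] at this
    omega
  · intro x y p q r s hp hq hr hs h1 h2 h3 h4 h5 h6
    have h7 := hcard x y {p, q, r, s} (by simp [hp, hq, hr, hs])
    rw [Finset.card_insert_of_notMem (by simp [h1, h2, h4]),
      Finset.card_eq_three.2 ⟨q, r, s, h3, h5, h6, rfl⟩] at h7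
    have := hle x {y}
    simp at this
    omega
  · intro x x' y hx hr
    rw [hrep] at hr
    -- By regularity the constant part of `shortCount` contributes `d` to both sides, so the excess
    -- `b` commutes with adjacency too.
    have h1 := G.sum_shortCount_neighbor_comm hdeg D x' y
    simp_rw [hb, Finset.sum_add_distrib, Finset.sum_const, card_neighborFinset_eq_degree,
      hdeg] at h1
    have h2 : b x y ≤ ∑ z ∈ G.neighborFinset x', b z y :=
      Finset.single_le_sum (f := fun z => b z y) (fun _ _ => Nat.zero_le _)
        (by simpa using hx.symm)
    have h3 : ∑ z ∈ G.neighborFinset y, b x' z ≠ 0 := by omega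
    obtain ⟨z, hz, hne⟩ := Finset.exists_ne_zero_of_sum_ne_zero h3
    exact ⟨z, by simpa using hz, (hrep _ _).2 (Nat.one_le_iff_ne_zero.2 hne)⟩
  · intro x
    by_cases h : ∃ y, 2 ≤ b x y
    · obtain ⟨y, hy⟩ := h
      right
      have h1 : 2 < (G.shortWalks D x y).card := by
        rw [card_shortWalks, hb]; omega
      obtain ⟨p, hp, q, hq, r, hr, h2, h3, h4⟩ := Finset.two_lt_card.1 h1
      exact ⟨y, p, q, r, G.mem_shortWalks.1 hp, G.mem_shortWalks.1 hq, G.mem_shortWalks.1 hr,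
        h2, h3, h4⟩
    · left
      push Not at h
      have h1 : ∑ y, b x y ≠ 0 := by rw [hsum]; norm_num
      obtain ⟨y, -, hy⟩ := Finset.exists_ne_zero_of_sum_ne_zero h1
      have h2 := Finset.add_sum_erase Finset.univ (b x) (Finset.mem_univ y)
      have h3 := h y
      have h4 : ∑ z ∈ Finset.univ.erase y, b x z ≠ 0 := by rw [hsum] at h2; omega
      obtain ⟨z, hz, hz0⟩ := Finset.exists_ne_zero_of_sum_ne_zero h4
      exact ⟨y, z, (Finset.ne_of_mem_erase hz).symm, (hrep _ _).2 (Nat.one_le_iff_ne_zero.2 hy),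
        (hrep _ _).2 (Nat.one_le_iff_ne_zero.2 hz0)⟩

end SimpleGraph

/-! ### Closed non-backtracking sequences and the lower bound on their length. -/

namespace SimpleGraph

variable {V : Type*} {G : SimpleGraph V} {d D : ℕ}

theorem exists_walk_of_seq (e : ℕ → V) (n : ℕ) (hadj : ∀ i < n, G.Adj (e i) (e (i + 1)))
    (hnb : ∀ i, i + 2 ≤ n → e i ≠ e (i + 2)) :
    ∃ p : G.Walk (e 0) (e n), p.length = n ∧ p.NB ∧ ∀ i ≤ n, p.getVert i = e i := by
  suffices H : ∃ p : G.Walk (e 0) (e n), p.length = n ∧ ∀ i ≤ n, p.getVert i = e i by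
    obtain ⟨p, h1, h2⟩ := H
    refine ⟨p, h1, ?_, h2⟩
    rw [Walk.nb_iff_getVert]
    intro i hi
    rw [h2 _ (by omega), h2 _ (by omega)]
    exact hnb i (by omega)
  clear hnb
  induction n with
  | zero => exact ⟨Walk.nil, rfl, fun i hi => by simp [Nat.le_zero.1 hi]⟩
  | succ n ih =>
    obtain ⟨p, h1, h2⟩ := ih fun i hi => hadj i (by omega)
    refine ⟨p.concat (hadj n (by omega)), by simp [h1], fun i hi => ?_⟩
    rw [Walk.concat_eq_append, Walk.getVert_append, h1]
    split_ifs with h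
    · exact h2 i h.le
    · obtain rfl | rfl : i = n ∨ i = n + 1 := by omega
      · simp
      · simp

/-- The bi-infinite sequence `e` runs without backtracking around a closed walk of length `L`. -/
structure IsCyclicSeq (G : SimpleGraph V) (e : ℤ → V) (L : ℕ) : Prop where
  adj : ∀ i, G.Adj (e i) (e (i + 1))
  nb : ∀ i, e i ≠ e (i + 2)
  per : ∀ i, e (i + L) = e i

namespace IsCyclicSeq

variable {e : ℤ → V} {L : ℕ}

theorem refl_at (h : IsCyclicSeq G e L) (c : ℤ) : IsCyclicSeq G (fun i => e (c - i)) L where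
  adj i := by
    have := (h.adj (c - (i + 1))).symm
    rwa [show c - (i + 1) + 1 = c - i by ring] at this
  nb i := by
    have := (h.nb (c - (i + 2))).symm
    rwa [show c - (i + 2) + 2 = c - i by ring] at this
  per i := by
    have := (h.per (c - (i + L))).symm
    rwa [show c - (i + L) + L = c - i by ring] at this

theorem per_mul (h : IsCyclicSeq G e L) (i k : ℤ) : e (i + k * L) = e i := by
  induction k using Int.induction_on with
  | zero => simp
  | succ k ih => rw [← ih, ← h.per (i + k * L)]; congr 1; ring
  | pred k ih => rw [← ih, ← h.per]; congr 1; ring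

theorem exists_walk (h : IsCyclicSeq G e L) (k : ℤ) (n : ℕ) :
    ∃ p : G.Walk (e k) (e (k + n)), p.length = n ∧ p.NB ∧ ∀ i ≤ n, p.getVert i = e (k + i) := by
  obtain ⟨p, h1, h2, h3⟩ := exists_walk_of_seq (G := G) (fun i : ℕ => e (k + i)) n
    (fun i _ => by have := h.adj (k + i); push_cast; rwa [add_assoc] at this)
    (fun i _ => by have := h.nb (k + i); push_cast; rwa [add_assoc] at this)
  refine ⟨p.copy (by simp) rfl, by simpa using h1, ?_, fun i hi => by simpa using h3 i hi⟩
  rw [Walk.nb_iff_getVert] at h2 ⊢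
  simpa using h2

theorem exists_two_walks (h : IsCyclicSeq G e L) (k l : ℤ) (a b : ℕ) (hL : a + b = L)
    (hl : l = k + a) (ha : 1 ≤ a) (hb : 1 ≤ b) :
    ∃ p q : G.Walk (e k) (e l), p ≠ q ∧ p.length = a ∧ q.length = b ∧ p.NB ∧ q.NB ∧
      (∀ i ≤ a, p.getVert i = e (k + i)) ∧ ∀ i ≤ b, q.getVert i = e (k - i) := by
  subst hl
  obtain ⟨p, p1, p2, p3⟩ := h.exists_walk k a
  obtain ⟨q, q1, q2, q3⟩ := (h.refl_at 0).exists_walk (-k) b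
  have hk : e (0 - (-k)) = e k := by simp
  have hkb : e (0 - (-k + b)) = e (k + a) := by
    rw [← h.per (0 - (-k + b)), ← hL]; congr 1; push_cast; ring
  have q3' : ∀ i ≤ b, (q.copy hk hkb).getVert i = e (k - i) := by
    intro i hi
    rw [Walk.getVert_copy, q3 i hi]; congr 1; ring
  refine ⟨p, q.copy hk hkb, ?_, p1, by simpa using q1, p2, ?_, p3, q3'⟩
  -- The two arcs already differ in their first steps, `e (k + 1)` and `e (k - 1)`.
  · intro hpq
    have h1 := p3 1 ha
    rw [hpq, q3' 1 hb] at h1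
    have h2 := h.nb (k - 1)
    rw [show k - 1 + 2 = k + 1 by ring] at h2
    exact h2 (by simpa using h1)
  · rw [Walk.nb_iff_getVert] at q2 ⊢
    simpa using q2

theorem repeat_of (h : IsCyclicSeq G e L) (k l : ℤ) (a b : ℕ) (hL : a + b = L)
    (hl : l = k + a) (ha : 1 ≤ a) (hb : 1 ≤ b) (haD : a ≤ D) (hbD : b ≤ D) :
    G.Repeat D (e k) (e l) := by
  obtain ⟨p, q, h1, h2, h3, h4, h5, -⟩ := h.exists_two_walks k l a b hL hl ha hb
  exact ⟨p, q, h1, ⟨h2 ▸ haD, h4⟩, ⟨h3 ▸ hbD, h5⟩⟩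

end IsCyclicSeq

theorem isCyclicSeq_of_nat (g : ℕ → V) (L : ℕ) (hL : 2 ≤ L) (h0 : g L = g 0)
    (hadj : ∀ i < L, G.Adj (g i) (g (i + 1))) (hnb : ∀ i, i + 2 ≤ L → g i ≠ g (i + 2))
    (hwrap : g (L - 1) ≠ g 1) :
    ∃ e : ℤ → V, IsCyclicSeq G e L ∧ ∀ i : ℕ, i ≤ L → e i = g i := by
  have hLZ : (L : ℤ) ≠ 0 := by omega
  have key : ∀ i : ℤ, ∃ j : ℕ, j < L ∧ i % L = j := fun i =>
    ⟨(i % L).toNat, by have := Int.emod_lt_of_pos i (b := L) (by omega); omega,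
      by have := Int.emod_nonneg i hLZ; omega⟩
  have hval : ∀ (i : ℤ) (j : ℕ), i % L = j → ∀ m : ℕ, j + m ≤ L →
      g ((i + m) % L).toNat = g (j + m) := by
    intro i j hj m hm
    rw [Int.add_emod, hj, Int.add_emod_emod]
    norm_cast
    rcases hm.lt_or_eq with h | h
    · rw [Nat.mod_eq_of_lt h]
    · rw [h, Nat.mod_self, h0]
  refine ⟨fun i => g (i % L).toNat, ⟨fun i => ?_, fun i => ?_, fun i => by simp⟩, fun i hi => ?_⟩
  · obtain ⟨j, hj, hij⟩ := key i
    have h1 := hval i j hij 0 (by omega)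
    have h2 := hval i j hij 1 (by omega)
    push_cast at h1 h2
    rw [add_zero] at h1
    rw [h1, h2]
    exact hadj j hj
  · obtain ⟨j, hj, hij⟩ := key i
    have h1 := hval i j hij 0 (by omega)
    push_cast at h1
    rw [add_zero] at h1
    by_cases hj2 : j + 2 ≤ L
    · have h2 := hval i j hij 2 hj2
      push_cast at h2
      rw [h1, h2]
      exact hnb j hj2
    · obtain rfl : j = L - 1 := by omega
      have h2 : (i + 1) % L = (0 : ℕ) := by
        rw [Int.add_emod, hij, Int.add_emod_emod]
        rw [show ((L - 1 : ℕ) : ℤ) + 1 = L by omega]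
        simp
      have h3 := hval (i + 1) 0 h2 1 (by omega)
      rw [show i + 1 + ((1 : ℕ) : ℤ) = i + 2 by push_cast; ring] at h3
      rw [h1, h3]
      exact hwrap
  · have := hval 0 0 (by simp) i (by omega)
    simpa using this

/-- Otherwise there is room to prolong both walks by one edge at `x`. Then `x` and all its
neighbours other than the two first steps are repeats of `y`; as `d ≥ 4` these are at least three.
-/
theorem RepeatLaws.eq_of_length_lt (h : G.RepeatLaws d D) (hd : 4 ≤ d) {x y : V}
    {p q : G.Walk x y} (hp : p.NB) (hq : q.NB) (hpD : p.length < D) (hqD : q.length < D) :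
    p = q := by
  classical
  by_contra hpq
  have hR : G.Repeat D x y := ⟨p, q, hpq, ⟨hpD.le, hp⟩, ⟨hqD.le, hq⟩⟩
  have hext : ∀ w, G.Adj x w → w ≠ p.getVert 1 → w ≠ q.getVert 1 → G.Repeat D y w := by
    intro w hw h1 h2
    refine Repeat.symm ⟨Walk.cons hw.symm p, Walk.cons hw.symm q, fun h => hpq (by simpa using h),
      ⟨by simpa using hpD, ?_⟩, ⟨by simpa using hqD, ?_⟩⟩
    · rw [Walk.nb_cons, Walk.nbFrom_iff]
      exact ⟨hp, fun _ => h1.symm⟩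
    · rw [Walk.nb_cons, Walk.nbFrom_iff]
      exact ⟨hq, fun _ => h2.symm⟩
  obtain ⟨w₁, hw₁, hs₁⟩ := h.exists_nbr x {p.getVert 1, q.getVert 1}
    (lt_of_le_of_lt Finset.card_le_two (by omega))
  obtain ⟨w₂, hw₂, hs₂⟩ := h.exists_nbr x {p.getVert 1, q.getVert 1, w₁}
    (lt_of_le_of_lt Finset.card_le_three (by omega))
  simp only [Finset.mem_insert, Finset.mem_singleton, not_or] at hs₁ hs₂
  exact h.not_three y x w₁ w₂ hw₁.ne hw₂.ne (Ne.symm hs₂.2.2) hR.symm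
    (hext w₁ hw₁ hs₁.1 hs₁.2) (hext w₂ hw₂ hs₂.1 hs₂.2.1)

/-- If the longer walk has length `D`, its first edge is moved to the other walk, or cancelled when
both begin with it; then both are shorter than `D`. -/
theorem RepeatLaws.eq_of_length_add (h : G.RepeatLaws d D) (hd : 4 ≤ d) (hD : 4 ≤ D) {x y : V}
    {p q : G.Walk x y} (hp : p.Short D) (hq : q.Short D)
    (hpq : p.length + q.length ≤ 2 * D - 2) : p = q := by
  wlog hle : q.length ≤ p.length generalizing p q
  · exact (this hq hp (by omega) (by omega)).symm
  by_cases hpD : p.length < D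
  · exact h.eq_of_length_lt hd hp.2 hq.2 hpD (by omega)
  cases p with
  | nil => simp at hpD; omega
  | @cons _ z _ hz p =>
    have hpD' := hp.1
    simp only [Walk.length_cons] at hpD hpq hpD'
    have hp2 := hp.2
    rw [Walk.nb_cons, Walk.nbFrom_iff] at hp2
    have hback : ¬ (0 < q.length → q.getVert 1 ≠ z) := by
      intro hq1
      have h1 : p = Walk.cons hz.symm q := by
        refine h.eq_of_length_lt hd hp2.1 ?_ (by omega) (by simp; omega)
        rw [Walk.nb_cons, Walk.nbFrom_iff]
        exact ⟨hq.2, hq1⟩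
      refine hp2.2 (by omega) ?_
      rw [h1]
      simp
    cases q with
    | nil => simp at hback
    | @cons _ z' _ hz' q =>
      obtain rfl : z' = z := by simpa using hback
      have hq2 := hq.2
      rw [Walk.nb_cons, Walk.nbFrom_iff] at hq2
      have hqD := hq.1
      simp only [Walk.length_cons] at hqD hpq
      rw [h.eq_of_length_lt hd (p := p) (q := q) hp2.1 hq2.1 (by omega) (by omega)]

theorem Walk.getVert_one_ne_of_ne {x y : V} {p q : G.Walk x y} (hpq : p ≠ q)
    (hp : 0 < p.length) (hq : 0 < q.length)
    (H : ∀ z (p' q' : G.Walk z y), p'.NBFrom x → q'.NBFrom x → p'.length < p.length →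
      q'.length < q.length → p' = q') (hpn : p.NB) (hqn : q.NB) :
    p.getVert 1 ≠ q.getVert 1 := by
  cases p with
  | nil => simp at hp
  | @cons _ z _ hz p =>
    cases q with
    | nil => simp at hq
    | @cons _ z' _ hz' q =>
      simp only [Walk.getVert_cons_succ, Walk.getVert_zero]
      rintro rfl
      exact hpq (by rw [H z p q hpn hqn (by simp) (by simp)])

/-- The sequence follows `p` forwards and `q` backwards. It does not backtrack at the junctions: a
common first or last edge could be removed, leaving walks shorter than `D`, which coincide. -/
theorem RepeatLaws.exists_isCyclicSeq (h : G.RepeatLaws d D) (hd : 4 ≤ d) (hD : 4 ≤ D) {x y : V}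
    {p q : G.Walk x y} (hp : p.Short D) (hq : q.Short D) (hpq : p ≠ q) :
    2 * D - 1 ≤ p.length + q.length ∧ ∃ e : ℤ → V, IsCyclicSeq G e (p.length + q.length) ∧
      (∀ i : ℕ, i ≤ p.length → e i = p.getVert i) ∧
      ∀ i : ℕ, i ≤ q.length → e (-i) = q.getVert i := by
  have hlen : 2 * D - 1 ≤ p.length + q.length := by
    by_contra hlt
    exact hpq (h.eq_of_length_add hd hD hp hq (by omega))
  refine ⟨hlen, ?_⟩
  have hpD := hp.1
  have hqD := hq.1
  have hp0 : 2 ≤ p.length := by omega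
  have hq0 : 2 ≤ q.length := by omega
  have hfirst : p.getVert 1 ≠ q.getVert 1 := by
    refine Walk.getVert_one_ne_of_ne hpq (by omega) (by omega) ?_ hp.2 hq.2
    intro z p' q' hp' hq' h1 h2
    rw [Walk.nbFrom_iff] at hp' hq'
    exact h.eq_of_length_lt hd hp'.1 hq'.1 (by omega) (by omega)
  have hlast : p.getVert (p.length - 1) ≠ q.getVert (q.length - 1) := by
    have := Walk.getVert_one_ne_of_ne (p := p.reverse) (q := q.reverse)
      (fun h => hpq (by simpa using congrArg Walk.reverse h)) (by simp; omega) (by simp; omega)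
      (by
        intro z p' q' hp' hq' h1 h2
        rw [Walk.nbFrom_iff] at hp' hq'
        rw [Walk.length_reverse] at h1 h2
        exact h.eq_of_length_lt hd hp'.1 hq'.1 (by omega) (by omega)) hp.2.reverse hq.2.reverse
    simpa using this
  have hpn := (Walk.nb_iff_getVert p).1 hp.2
  have hqn := (Walk.nb_iff_getVert q).1 hq.2
  set a := p.length with ha
  set b := q.length with hb
  obtain ⟨g, hgp, hgq⟩ : ∃ g : ℕ → V, (∀ i ≤ a, g i = p.getVert i) ∧
      ∀ i, a ≤ i → i ≤ a + b → g i = q.getVert (a + b - i) := by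
    refine ⟨fun i => if i ≤ a then p.getVert i else q.getVert (a + b - i), fun i hi => if_pos hi,
      fun i hi hi' => ?_⟩
    dsimp only
    split_ifs with h1
    · rw [show i = a by omega, show a + b - a = b by omega, hb, ha]
      simp
    · rfl
  obtain ⟨e, he, heg⟩ := isCyclicSeq_of_nat (G := G) g (a + b) (by omega)
    (by rw [hgp 0 (by omega), hgq _ (by omega) le_rfl]; simp)
    (by
      intro i hi
      by_cases h1 : i < a
      · rw [hgp i h1.le, hgp _ h1]
        exact p.adj_getVert_succ h1
      · rw [hgq i (by omega) (by omega), hgq (i + 1) (by omega) (by omega),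
          show a + b - i = a + b - (i + 1) + 1 by omega]
        exact (q.adj_getVert_succ (by omega)).symm)
    (by
      intro i hi
      by_cases h1 : i + 2 ≤ a
      · rw [hgp i (by omega), hgp _ h1]
        exact hpn i h1
      · by_cases h2 : a ≤ i
        · rw [hgq i h2 (by omega), hgq (i + 2) (by omega) (by omega),
            show a + b - i = a + b - (i + 2) + 2 by omega]
          exact (hqn _ (by omega)).symm
        · obtain rfl : i = a - 1 := by omega
          rw [hgp _ (by omega), hgq _ (by omega) (by omega),
            show a + b - (a - 1 + 2) = b - 1 by omega]
          exact hlast)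
    (by
      rw [hgp 1 (by omega), hgq _ (by omega) (by omega), show a + b - (a + b - 1) = 1 by omega]
      exact hfirst.symm)
  refine ⟨e, he, fun i hi => by rw [heg i (by omega), hgp i hi], fun i hi => ?_⟩
  rw [← he.per, show (-i : ℤ) + (a + b : ℕ) = ((a + b - i : ℕ) : ℤ) by omega, heg _ (by omega),
    hgq _ (by omega) (by omega), show a + b - (a + b - i) = i by omega]

/-! ### Saturated sets. -/

/-- Short walks between a vertex of `S` and one of its repeats stay in `S`. -/
def IsSaturated (G : SimpleGraph V) (D : ℕ) (S : Set V) : Prop :=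
  ∀ x ∈ S, ∀ y, G.Repeat D x y → ∀ p : G.Walk x y, p.Short D → ∀ v ∈ p.support, v ∈ S

/-- Saturation test at a vertex with two repeats: the four known walks exhaust the total excess 2,
so any short walk to a repeat is one of them. -/
theorem RepeatLaws.support_of_two (h : G.RepeatLaws d D) {S : Set V} {x y₁ y₂ : V}
    (hy : y₁ ≠ y₂) {p₁ q₁ : G.Walk x y₁} {p₂ q₂ : G.Walk x y₂} (hpq₁ : p₁ ≠ q₁) (hpq₂ : p₂ ≠ q₂)
    (hp₁ : p₁.Short D) (hq₁ : q₁.Short D) (hp₂ : p₂.Short D) (hq₂ : q₂.Short D)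
    (sp₁ : ∀ v ∈ p₁.support, v ∈ S) (sq₁ : ∀ v ∈ q₁.support, v ∈ S)
    (sp₂ : ∀ v ∈ p₂.support, v ∈ S) (sq₂ : ∀ v ∈ q₂.support, v ∈ S)
    {y : V} (hr : G.Repeat D x y) (p : G.Walk x y) (hp : p.Short D) : ∀ v ∈ p.support, v ∈ S := by
  have r₁ : G.Repeat D x y₁ := ⟨p₁, q₁, hpq₁, hp₁, hq₁⟩
  have r₂ : G.Repeat D x y₂ := ⟨p₂, q₂, hpq₂, hp₂, hq₂⟩
  by_cases h1 : y = y₁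
  · subst h1
    by_cases e1 : p = p₁
    · exact e1 ▸ sp₁
    by_cases e2 : p = q₁
    · exact e2 ▸ sq₁
    exact (h.not_three_walks x y y₂ hy r₂ p p₁ q₁ hp hp₁ hq₁ e1 e2 hpq₁).elim
  by_cases h2 : y = y₂
  · subst h2
    by_cases e1 : p = p₂
    · exact e1 ▸ sp₂
    by_cases e2 : p = q₂
    · exact e2 ▸ sq₂
    exact (h.not_three_walks x y y₁ hy.symm r₁ p p₂ q₂ hp hp₂ hq₂ e1 e2 hpq₂).elim
  exact (h.not_three x y y₁ y₂ h1 h2 hy hr r₁ r₂).elim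

theorem RepeatLaws.support_of_three (h : G.RepeatLaws d D) {S : Set V} {x z : V}
    {p₁ p₂ p₃ : G.Walk x z} (h₁₂ : p₁ ≠ p₂) (h₁₃ : p₁ ≠ p₃) (h₂₃ : p₂ ≠ p₃)
    (hp₁ : p₁.Short D) (hp₂ : p₂.Short D) (hp₃ : p₃.Short D)
    (s₁ : ∀ v ∈ p₁.support, v ∈ S) (s₂ : ∀ v ∈ p₂.support, v ∈ S) (s₃ : ∀ v ∈ p₃.support, v ∈ S)
    {y : V} (hr : G.Repeat D x y) (p : G.Walk x y) (hp : p.Short D) : ∀ v ∈ p.support, v ∈ S := by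
  by_cases h1 : y = z
  · subst h1
    by_cases e1 : p = p₁
    · exact e1 ▸ s₁
    by_cases e2 : p = p₂
    · exact e2 ▸ s₂
    by_cases e3 : p = p₃
    · exact e3 ▸ s₃
    exact (h.not_four_walks x y p p₁ p₂ p₃ hp hp₁ hp₂ hp₃ e1 e2 h₁₂ e3 h₁₃ h₂₃).elim
  exact (h.not_three_walks x z y (Ne.symm h1) hr p₁ p₂ p₃ hp₁ hp₂ hp₃ h₁₂ h₁₃ h₂₃).elim

theorem Walk.NB.append {x y z : V} {p : G.Walk x y} {q : G.Walk y z} (hp : p.NB) (hq : q.NB)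
    (hj : 0 < p.length → 0 < q.length → p.getVert (p.length - 1) ≠ q.getVert 1) :
    (p.append q).NB := by
  rw [Walk.nb_iff_getVert] at *
  intro i hi
  rw [Walk.length_append] at hi
  rw [Walk.getVert_append, Walk.getVert_append]
  split_ifs with h1 h2 h2
  · exact hp i h2.le
  · by_cases h3 : i + 2 = p.length
    · have := hp i h3.le
      rw [h3, Walk.getVert_length] at this
      rwa [h3, Nat.sub_self, Walk.getVert_zero]
    · rw [show i + 2 - p.length = 1 by omega, show i = p.length - 1 by omega]
      exact hj (by omega) (by omega)
  · omega
  · rw [show i + 2 - p.length = i - p.length + 2 by omega]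
    exact hq _ (by omega)

/-- A saturated set has no short excursion: a walk inside `S` and a walk outside `S` cannot be
joined to a closed walk of length at most `2D`. -/
theorem IsSaturated.no_excursion {S : Set V} (hS : IsSaturated G D S) {z t w t' : V}
    (σ : G.Walk z t) (hσ : σ.NB) (hσS : ∀ v ∈ σ.support, v ∈ S) (hzw : G.Adj z w)
    (htt : G.Adj t t') (ρ : G.Walk w t') (hρ : ∀ v ∈ ρ.support, v ∉ S)
    (h1 : 1 ≤ σ.length) (h2 : σ.length < D) (h3 : σ.length + 2 + ρ.length ≤ 2 * D) : False := by
  classical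
  obtain ⟨π, hπ, hπS, hπl⟩ : ∃ π : G.Walk w t', π.IsPath ∧ (∀ v ∈ π.support, v ∉ S) ∧
      π.length ≤ ρ.length :=
    ⟨ρ.bypass, ρ.bypass_isPath, fun v hv => hρ v (ρ.support_bypass_subset_support hv),
      ρ.length_bypass_le_length⟩
  -- A vertex of the outside walk at which both ways round from `z` have length at most `D`; it
  -- becomes a repeat of `z` outside `S`.
  obtain ⟨j, hj, hj1, hj2⟩ : ∃ j, j ≤ π.length ∧ j + 1 ≤ D ∧ σ.length + 1 + (π.length - j) ≤ D := by
    by_cases h : π.length + 1 ≤ D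
    · exact ⟨π.length, le_rfl, h, by omega⟩
    · exact ⟨D - 1, by omega, by omega, by omega⟩
  have hzS : z ∈ S := hσS _ σ.start_mem_support
  have htS : t ∈ S := hσS _ σ.end_mem_support
  have hout : ∀ i, π.getVert i ∉ S := fun i => hπS _ (π.getVert_mem_support i)
  have hin : ∀ i, σ.getVert i ∈ S := fun i => hσS _ (σ.getVert_mem_support i)
  set p : G.Walk z (π.getVert j) := Walk.cons hzw (π.take j) with hp
  set q : G.Walk z (π.getVert j) := σ.append (Walk.cons htt (π.drop j).reverse) with hq
  have hpn : p.Short D := by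
    refine ⟨by simp [hp]; omega, ?_⟩
    rw [hp, Walk.nb_cons, Walk.nbFrom_iff]
    exact ⟨(hπ.take j).nb, fun _ h => hout _ ((Walk.take_getVert π j 1) ▸ h ▸ hzS)⟩
  have hqn : q.Short D := by
    refine ⟨by simp [hq]; omega, ?_⟩
    refine hσ.append ?_ ?_
    · rw [Walk.nb_cons, Walk.nbFrom_iff]
      refine ⟨(hπ.drop j).reverse.nb, fun _ h => ?_⟩
      rw [Walk.getVert_reverse, Walk.drop_getVert] at h
      exact hout _ (h ▸ htS)
    · intro _ _ h
      have h4 := hin (σ.length - 1)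
      rw [h] at h4
      simp only [Walk.getVert_cons_succ, Walk.getVert_zero] at h4
      exact hπS _ π.end_mem_support h4
  have hpq : p ≠ q := by
    intro h
    have h4 : p.getVert 1 = w := by simp [hp]
    have h5 : q.getVert 1 = σ.getVert 1 := by
      rw [hq, Walk.getVert_append']
      rw [if_pos h1]
    rw [h, h5] at h4
    exact hπS _ π.start_mem_support (h4 ▸ hin 1)
  exact hout j (hS z hzS _ ⟨p, q, hpq, hpn, hqn⟩ p hpn _ p.end_mem_support)

end SimpleGraph

/-! ### The parallel walk of second repeats. -/

namespace SimpleGraph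

variable {V : Type*} {G : SimpleGraph V} {d D : ℕ}

theorem RepeatLaws.eq_of_repeat (h : G.RepeatLaws d D) {x y y₁ y₂ : V} (hy : G.Repeat D x y)
    (h₁ : G.Repeat D x y₁) (h₂ : G.Repeat D x y₂) (n₁ : y₁ ≠ y) (n₂ : y₂ ≠ y) : y₁ = y₂ := by
  by_contra hne
  exact h.not_three x y y₁ y₂ n₁.symm n₂.symm hne hy h₁ h₂

theorem RepeatLaws.exists_isCyclicSeq_of_repeat (h : G.RepeatLaws d D) (hd : 4 ≤ d) (hD : 4 ≤ D)
    {x y : V} (hr : G.Repeat D x y) : ∃ (e : ℤ → V) (a b : ℕ), a ≤ D ∧ b ≤ D ∧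
      2 * D - 1 ≤ a + b ∧ IsCyclicSeq G e (a + b) ∧ e 0 = x ∧ e a = y := by
  obtain ⟨p, q, hpq, hp, hq⟩ := hr
  obtain ⟨h1, e, h2, h3, -⟩ := h.exists_isCyclicSeq hd hD hp hq hpq
  exact ⟨e, p.length, q.length, hp.1, hq.1, h1, h2, by simpa using h3 0 (by omega),
    by simpa using h3 p.length le_rfl⟩

theorem IsSaturated.mem_of_repeat {S : Set V} (hS : IsSaturated G D S) {x y : V} (hx : x ∈ S)
    (hr : G.Repeat D x y) : y ∈ S := by
  obtain ⟨p, q, hpq, hp, hq⟩ := hr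
  exact hS x hx y ⟨p, q, hpq, hp, hq⟩ p hp y p.end_mem_support

theorem IsSaturated.notMem_of_repeat {S : Set V} (hS : IsSaturated G D S) {x y : V} (hx : x ∉ S)
    (hr : G.Repeat D x y) : y ∉ S := fun hy => hx (hS.mem_of_repeat hy hr.symm)

/-- A vertex in `S` drags its successor into `S`, since the arc to its antipode is a short walk to a
repeat; continuing round the sequence reaches `e 0`. -/
theorem IsSaturated.notMem_of_isCyclicSeq {S : Set V} (hS : IsSaturated G D S) (hD : 1 ≤ D)
    {e : ℤ → V} (he : IsCyclicSeq G e (2 * D)) (h0 : e 0 ∉ S) (i : ℤ) : e i ∉ S := by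
  have hstep : ∀ i, e i ∈ S → e (i + 1) ∈ S := by
    intro i hi
    obtain ⟨p, q, h1, h2, h3, h4, h5, h6, -⟩ :=
      he.exists_two_walks i (i + D) D D (by ring) rfl hD hD
    have h7 := h6 1 hD
    push_cast at h7
    rw [← h7]
    exact hS _ hi _ ⟨p, q, h1, ⟨h2.le, h4⟩, ⟨h3.le, h5⟩⟩ p ⟨h2.le, h4⟩ _ (p.getVert_mem_support 1)
  have hsteps : ∀ n : ℕ, e i ∈ S → e (i + n) ∈ S := by
    intro n hi
    induction n with
    | zero => simpa using hi
    | succ n ih =>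
      have := hstep _ ih
      push_cast
      rwa [← add_assoc]
  intro hi
  have hle : i ≤ |i| * (2 * D : ℕ) := by
    have h1 : i ≤ |i| := le_abs_self i
    have h2 : (0 : ℤ) ≤ |i| := abs_nonneg i
    have h3 : (1 : ℤ) ≤ (2 * D : ℕ) := by push_cast; omega
    nlinarith
  have h1 := hsteps (|i| * (2 * D : ℕ) - i).toNat hi
  rw [Int.toNat_of_nonneg (by omega), show i + (|i| * (2 * D : ℕ) - i) = 0 + |i| * (2 * D : ℕ) by
    ring, he.per_mul] at h1
  exact h0 h1

/-- As `e i` advances, transport carries its second repeat along a walk from `w`. It cannot meet the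
antipode `e (i + D)`: the antipodes run along a walk from `e D`, and the two walks would close up
with `σ` to length at most 2 + 2 + 2(D - 2) = 2D. -/
theorem IsSaturated.exists_parallel {S : Set V} (hS : IsSaturated G D S) (h : G.RepeatLaws d D)
    (hD : 4 ≤ D) {e : ℤ → V} (he : IsCyclicSeq G e (2 * D)) (heS : ∀ i, e i ∉ S) {y z w : V}
    (σ : G.Walk y z) (hσ : σ.NB) (hσS : ∀ v ∈ σ.support, v ∈ S) (hσ1 : 1 ≤ σ.length)
    (hσ2 : σ.length ≤ 2) (hyv : G.Adj y (e D)) (hzw : G.Adj z w) (hr : G.Repeat D (e 0) w)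
    (i : ℕ) (hi : i ≤ D - 2) :
    ∃ (z' : V) (ρ : G.Walk w z'), ρ.length = i ∧ (∀ v ∈ ρ.support, v ∉ S) ∧
      G.Repeat D (e i) z' ∧ z' ≠ e (i + D) := by
  have hne : ∀ (j : ℕ) (z' : V) (ρ : G.Walk w z'), j ≤ D - 2 → ρ.length = j →
      (∀ v ∈ ρ.support, v ∉ S) → z' ≠ e (j + D) := by
    rintro j z' ρ hj hρ hρS rfl
    obtain ⟨p, p1, -, p3⟩ := he.exists_walk D j
    have hend : e (D + j) = e (j + D) := by rw [add_comm]
    refine hS.no_excursion σ hσ hσS hyv hzw ((p.copy rfl hend).append ρ.reverse) ?_ hσ1 (by omega)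
      (by simp [p1, hρ]; omega)
    intro v hv
    rw [Walk.mem_support_append_iff, Walk.support_copy, Walk.support_reverse,
      List.mem_reverse] at hv
    rcases hv with hv | hv
    · obtain ⟨n, rfl, hn⟩ := Walk.mem_support_iff_exists_getVert.1 hv
      rw [p3 n (p1 ▸ hn)]
      exact heS _
    · exact hρS v hv
  induction i with
  | zero =>
    have hw : w ∉ S := hS.notMem_of_repeat (heS 0) hr
    have h1 : ∀ v ∈ (Walk.nil : G.Walk w w).support, v ∉ S := by simpa using hw
    exact ⟨w, Walk.nil, rfl, h1, by simpa using hr, hne 0 w Walk.nil (by omega) rfl h1⟩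
  | succ i ih =>
    obtain ⟨z₁, ρ, h1, h2, h3, -⟩ := ih (by omega)
    obtain ⟨z₂, h4, h5⟩ := h.transport _ _ _ (he.adj i) h3
    have h6 : z₂ ∉ S := hS.notMem_of_repeat (heS _) h5
    have h7 : ∀ v ∈ (ρ.concat h4).support, v ∉ S := by
      intro v hv
      rw [Walk.support_concat, List.mem_append, List.mem_singleton] at hv
      rcases hv with hv | rfl
      · exact h2 v hv
      · exact h6
    refine ⟨z₂, ρ.concat h4, by simp [h1], h7, by exact_mod_cast h5, ?_⟩
    exact hne (i + 1) z₂ _ hi (by simp [h1]) h7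

/-- The repeats `v`, `w` of `u` lie next to `y`, `z`. On the 2D-cycle through `u` and its antipode
`v`, second repeats are followed from both ends; they meet and give a walk of length `D` outside `S`
from `w` to a neighbour of `t`. With `μ` and two edges it closes up to length 2D. -/
theorem IsSaturated.false_of_parallel {S : Set V} (hS : IsSaturated G D S) (h : G.RepeatLaws d D)
    (hd : 4 ≤ d) (hD : 4 ≤ D) {x y z t u : V}
    (hxy : G.Repeat D x y) (hxz : G.Repeat D x z) (hyt : G.Repeat D y t)
    (σ : G.Walk y z) (hσ : σ.NB) (hσS : ∀ v ∈ σ.support, v ∈ S) (hσ1 : 1 ≤ σ.length)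
    (hσ2 : σ.length ≤ 2)
    (τ : G.Walk x t) (hτ : τ.NB) (hτS : ∀ v ∈ τ.support, v ∈ S) (hτ1 : 1 ≤ τ.length)
    (hτ2 : τ.length ≤ 2)
    (μ : G.Walk z t) (hμ : μ.NB) (hμS : ∀ v ∈ μ.support, v ∈ S) (hμ1 : μ.length = D - 2)
    (hxu : G.Adj x u) (huS : u ∉ S) : False := by
  obtain ⟨v, hyv, huv⟩ := h.transport x u y hxu hxy
  obtain ⟨w, hzw, huw⟩ := h.transport x u z hxu hxz
  have hvS := hS.notMem_of_repeat huS huv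
  have hwS := hS.notMem_of_repeat huS huw
  obtain ⟨t', htt, hvt⟩ := h.transport y v t hyv hyt
  have htS := hS.notMem_of_repeat hvS hvt
  have hnadj : ¬ G.Adj v w := fun hvw =>
    hS.no_excursion σ hσ hσS hyv hzw hvw.toWalk (by simp [hvS, hwS]) hσ1 (by omega)
      (by simp; omega)
  have hvw : v ≠ w := by
    rintro rfl
    exact hS.no_excursion σ hσ hσS hyv hzw Walk.nil (by simp [hvS]) hσ1 (by omega)
      (by simp; omega)
  obtain ⟨e, a, b, ha, hb, hab, he, rfl, rfl⟩ := h.exists_isCyclicSeq_of_repeat hd hD huv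
  -- On a closed sequence of length 2D - 1, `u` would have a second repeat adjacent to `v`. It would
  -- have to be `w`, which is not adjacent to `v`.
  have hfull : D = a ∧ D = b := by
    by_contra hne
    have hlt : a + b + 1 = 2 * D := by omega
    rcases (by omega : a = D ∧ b = D - 1 ∨ a = D - 1 ∧ b = D) with ⟨rfl, hb'⟩ | ⟨ha', rfl⟩
    · have h1 : G.Repeat a (e 0) (e (a - 1)) :=
        he.repeat_of 0 (a - 1) (a - 1) (b + 1) (by omega) (by omega) (by omega) (by omega)
          (by omega) (by omega)
      have h2 : G.Adj (e (a - 1)) (e a) := by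
        have := he.adj (a - 1)
        rwa [sub_add_cancel] at this
      have h3 := h.eq_of_repeat huv h1 huw h2.ne hvw.symm
      exact hnadj (h3 ▸ h2.symm)
    · have h1 : G.Repeat b (e 0) (e (a + 1)) :=
        he.repeat_of 0 (a + 1) (a + 1) (b - 1) (by omega) (by push_cast; ring) (by omega)
          (by omega) (by omega) (by omega)
      have h3 := h.eq_of_repeat huv h1 huw (he.adj a).ne.symm hvw.symm
      exact hnadj (h3 ▸ he.adj a)
  obtain ⟨rfl, rfl⟩ := hfull
  rw [← two_mul] at he
  have heS := hS.notMem_of_isCyclicSeq (by omega) he huS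
  obtain ⟨z₁, ρ₁, l₁, s₁, r₁, n₁⟩ := hS.exists_parallel h hD he heS σ hσ hσS hσ1 hσ2 hyv hzw huw 2
    (by omega)
  -- The reversed sequence starts at `v`; after D - 2 steps it stands at `e 2`, where the first walk
  -- of second repeats stopped.
  obtain ⟨z₂, ρ₂, l₂, s₂, r₂, n₂⟩ := hS.exists_parallel h hD (he.refl_at D) (fun i => heS _) τ hτ
    hτS hτ1 hτ2 (by simpa using hxu) htt (by simpa using hvt) (D - 2) le_rfl
  have hz : z₁ = z₂ := by
    have e1 : (D : ℤ) - ((D - 2 : ℕ) : ℤ) = ((2 : ℕ) : ℤ) := by omega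
    have e2 : e ((D : ℤ) - (((D - 2 : ℕ) : ℤ) + D)) = e (((2 : ℕ) : ℤ) + D) := by
      rw [← he.per]
      congr 1
      push_cast
      omega
    rw [e2] at n₂
    rw [e1] at r₂
    exact h.eq_of_repeat (he.repeat_of _ _ D D (by ring) rfl (by omega) (by omega) le_rfl le_rfl)
      r₁ r₂ n₁ n₂
  subst hz
  refine hS.no_excursion μ hμ hμS hzw htt (ρ₁.append ρ₂.reverse) ?_ (by omega) (by omega)
    (by simp [l₁, l₂]; omega)
  intro v hv
  rw [Walk.mem_support_append_iff, Walk.support_reverse, List.mem_reverse] at hv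
  exact hv.elim (s₁ v) (s₂ v)

end SimpleGraph

/-! ### Excluding closed sequences of length 2D - 1 and triple short walks. -/

namespace SimpleGraph

variable {V : Type*} {G : SimpleGraph V} {d D : ℕ}

theorem Walk.NB.copy {x y x' y' : V} {p : G.Walk x y} (hp : p.NB) (hx : x = x') (hy : y = y') :
    (p.copy hx hy).NB := by
  subst hx hy
  exact hp

theorem Walk.Short.reverse {x y : V} {p : G.Walk x y} (hp : p.Short D) : p.reverse.Short D :=
  ⟨by simpa using hp.1, hp.2.reverse⟩

theorem Walk.mem_of_getVert {S : Set V} {x y : V} {p : G.Walk x y} {f : ℕ → V} {n : ℕ}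
    (hn : p.length = n) (hp : ∀ i ≤ n, p.getVert i = f i) (hf : ∀ i ≤ n, f i ∈ S) :
    ∀ v ∈ p.support, v ∈ S := by
  intro v hv
  obtain ⟨i, rfl, hi⟩ := Walk.mem_support_iff_exists_getVert.1 hv
  rw [hp i (hn ▸ hi)]
  exact hf i (hn ▸ hi)

theorem RepeatLaws.length_eq_zero_of_closed (h : G.RepeatLaws d D) (hd : 4 ≤ d) (hD : 4 ≤ D)
    {x : V} {p : G.Walk x x} (hp : p.Short D) : p.length = 0 := by
  have hp1 := hp.1
  have := h.eq_of_length_add hd hD (p := p) (q := Walk.nil) hp ⟨by simp, Walk.nb_nil⟩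
    (by simp; omega)
  simp [this]

namespace IsCyclicSeq

variable {e : ℤ → V} {L : ℕ}

/-- One of the two arcs has length at most `D`; if its ends coincided it would be a nontrivial
closed short walk. -/
theorem ne_of_lt (he : IsCyclicSeq G e L) (h : G.RepeatLaws d D) (hd : 4 ≤ d) (hD : 4 ≤ D)
    (hL : L ≤ 2 * D) {i j : ℤ} (hij : i < j) (hji : j < i + L) : e i ≠ e j := by
  have key : ∀ (i : ℤ) (n : ℕ), 0 < n → n ≤ D → e i ≠ e (i + n) := by
    intro i n hn hnD heq
    obtain ⟨p, p1, p2, -⟩ := he.exists_walk i n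
    have := h.length_eq_zero_of_closed hd hD (p := p.copy rfl heq.symm)
      ⟨by rwa [Walk.length_copy, p1], p2.copy _ _⟩
    rw [Walk.length_copy] at this
    omega
  by_cases hn : j ≤ i + D
  · have := key i (j - i).toNat (by omega) (by omega)
    rwa [Int.toNat_of_nonneg (by omega), add_sub_cancel] at this
  · have := key j (i + L - j).toNat (by omega) (by omega)
    rw [Int.toNat_of_nonneg (by omega), add_sub_cancel, he.per] at this
    exact this.symm

/-- No chords: a chord and the shorter arc have total length at most D + 1 ≤ 2D - 2, so they
coincide as walks. -/
theorem eq_of_adj (he : IsCyclicSeq G e L) (h : G.RepeatLaws d D) (hd : 4 ≤ d) (hD : 4 ≤ D)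
    (hL : L ≤ 2 * D) {i j : ℤ} (hij : i ≤ j) (hji : j < i + L) (hadj : G.Adj (e i) (e j)) :
    j = i + 1 ∨ j = i + L - 1 := by
  have key : ∀ (i : ℤ) (n : ℕ), n ≤ D → G.Adj (e i) (e (i + n)) → n = 1 := by
    intro i n hnD hadj
    obtain ⟨p, p1, p2, -⟩ := he.exists_walk i n
    have := h.eq_of_length_add hd hD (p := p) (q := hadj.toWalk) ⟨p1.trans_le hnD, p2⟩
      ⟨by simp; omega, trivial⟩ (by simp [p1]; omega)
    rw [← p1, this]
    simp
  by_cases hn : j ≤ i + D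
  · left
    have := key i (j - i).toNat (by omega)
      (by rwa [Int.toNat_of_nonneg (by omega), add_sub_cancel])
    omega
  · right
    have := key j (i + L - j).toNat (by omega)
      (by rw [Int.toNat_of_nonneg (by omega), add_sub_cancel, he.per]; exact hadj.symm)
    omega

theorem exists_eq (he : IsCyclicSeq G e L) (hL : 0 < L) (c i : ℤ) :
    ∃ j, c ≤ j ∧ j < c + L ∧ e i = e j := by
  have h1 := Int.emod_nonneg (i - c) (b := L) (by omega)
  have h2 := Int.emod_lt_of_pos (i - c) (b := L) (by omega)
  refine ⟨c + (i - c) % L, by omega, by omega, ?_⟩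
  rw [← he.per_mul (c + (i - c) % L) ((i - c) / L)]
  congr 1
  have := Int.emod_add_mul_ediv (i - c) L
  linarith [mul_comm (L : ℤ) ((i - c) / L)]

end IsCyclicSeq

/-- Each `e k` has the two repeats `e (k + D)` and `e (k + D - 1)`, so the sequence is saturated.
Having no chords, it is left by an edge at `e 0`, and `false_of_parallel` applies with y = e(D - 1),
z = e(D), t = e(-1). -/
theorem RepeatLaws.not_isCyclicSeq_odd (h : G.RepeatLaws d D) (hd : 4 ≤ d) (hD : 4 ≤ D)
    (e : ℤ → V) : ¬ IsCyclicSeq G e (2 * D - 1) := by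
  intro he
  have hS : IsSaturated G D (Set.range e) := by
    rintro _ ⟨k, rfl⟩ y hr p hp
    obtain ⟨p₁, q₁, n₁, lp₁, lq₁, bp₁, bq₁, gp₁, gq₁⟩ :=
      he.exists_two_walks k (k + D) D (D - 1) (by omega) rfl (by omega) (by omega)
    obtain ⟨p₂, q₂, n₂, lp₂, lq₂, bp₂, bq₂, gp₂, gq₂⟩ :=
      he.exists_two_walks k (k + D - 1) (D - 1) D (by omega) (by omega) (by omega) (by omega)
    have hne : e (k + D) ≠ e (k + D - 1) := by
      have := he.adj (k + D - 1)
      rw [sub_add_cancel] at this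
      exact this.ne.symm
    refine h.support_of_two hne n₁ n₂ ⟨by omega, bp₁⟩ ⟨by omega, bq₁⟩ ⟨by omega, bp₂⟩
      ⟨by omega, bq₂⟩ ?_ ?_ ?_ ?_ hr p hp
    · exact Walk.mem_of_getVert lp₁ gp₁ fun i _ => ⟨_, rfl⟩
    · exact Walk.mem_of_getVert lq₁ gq₁ fun i _ => ⟨_, rfl⟩
    · exact Walk.mem_of_getVert lp₂ gp₂ fun i _ => ⟨_, rfl⟩
    · exact Walk.mem_of_getVert lq₂ gq₂ fun i _ => ⟨_, rfl⟩
  obtain ⟨u, hu, hus⟩ := by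
    classical exact h.exists_nbr (e 0) {e 1, e (-1)} (lt_of_le_of_lt Finset.card_le_two (by omega))
  have huS : u ∉ Set.range e := by
    rintro ⟨i, rfl⟩
    obtain ⟨j, hj1, hj2, hij⟩ := he.exists_eq (by omega) 0 i
    rw [hij] at hu hus
    simp only [Finset.mem_insert, Finset.mem_singleton, not_or] at hus
    rcases he.eq_of_adj h hd hD (by omega) hj1 hj2 hu with h1 | h1
    · exact hus.1 (by rw [h1, zero_add])
    · refine hus.2 ?_
      rw [h1, ← he.per (-1)]
      congr 1
      ring
  have hxy : G.Repeat D (e 0) (e (D - 1)) :=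
    he.repeat_of 0 (D - 1) (D - 1) D (by omega) (by omega) (by omega) (by omega) (by omega) le_rfl
  have hxz : G.Repeat D (e 0) (e D) :=
    he.repeat_of 0 D D (D - 1) (by omega) (by omega) (by omega) (by omega) (by omega) (by omega)
  have ht : e (2 * D - 2) = e (-1) := by
    rw [← he.per (-1)]
    congr 1
    omega
  have hyt : G.Repeat D (e (D - 1)) (e (-1)) :=
    ht ▸ he.repeat_of (D - 1) (2 * D - 2) (D - 1) D (by omega) (by omega) (by omega) (by omega)
      (by omega) le_rfl
  obtain ⟨σ, σ1, σ2, σ3⟩ := he.exists_walk (D - 1) 1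
  obtain ⟨τ, τ1, τ2, τ3⟩ := he.exists_walk (-1) 1
  obtain ⟨μ, μ1, μ2, μ3⟩ := he.exists_walk D (D - 2)
  have hσ : e (D - 1 + (1 : ℕ)) = e D := by congr 1; push_cast; ring
  have hτ : e (-1 + (1 : ℕ)) = e 0 := by congr 1
  have hμ : e (D + (D - 2 : ℕ)) = e (-1) := by rw [← ht]; congr 1; omega
  have sσ := Walk.mem_of_getVert (S := Set.range e) σ1 σ3 fun i _ => ⟨_, rfl⟩
  have sτ := Walk.mem_of_getVert (S := Set.range e) τ1 τ3 fun i _ => ⟨_, rfl⟩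
  have sμ := Walk.mem_of_getVert (S := Set.range e) μ1 μ3 fun i _ => ⟨_, rfl⟩
  exact hS.false_of_parallel h hd hD hxy hxz hyt (σ.copy rfl hσ) (σ2.copy _ _)
    (by simpa using sσ) (by simp [σ1]) (by simp [σ1]) (τ.copy rfl hτ).reverse
    (τ2.copy _ _).reverse (by simpa using sτ) (by simp [τ1]) (by simp [τ1]) (μ.copy rfl hμ)
    (μ2.copy _ _) (by simpa using sμ) (by simp [μ1]) hu huS

theorem RepeatLaws.length_eq_of_ne (h : G.RepeatLaws d D) (hd : 4 ≤ d) (hD : 4 ≤ D) {x y : V}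
    {p q : G.Walk x y} (hp : p.Short D) (hq : q.Short D) (hpq : p ≠ q) : p.length = D := by
  obtain ⟨h1, e, h2, -⟩ := h.exists_isCyclicSeq hd hD hp hq hpq
  have hp1 := hp.1
  have hq1 := hq.1
  by_contra hne
  rw [show p.length + q.length = 2 * D - 1 by omega] at h2
  exact h.not_isCyclicSeq_odd hd hD e h2

/-- Two different short walks with the same ends form a closed walk of length `2D`. -/
theorem RepeatLaws.exists_isCyclicSeq_two_mul (h : G.RepeatLaws d D) (hd : 4 ≤ d) (hD : 4 ≤ D)
    {x y : V} {p q : G.Walk x y} (hp : p.Short D) (hq : q.Short D) (hpq : p ≠ q) :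
    ∃ e : ℤ → V, IsCyclicSeq G e (2 * D) ∧ (∀ i : ℕ, i ≤ D → e i = p.getVert i) ∧
      ∀ i : ℕ, i ≤ D → e (-i) = q.getVert i := by
  obtain ⟨-, e, h2, h3, h4⟩ := h.exists_isCyclicSeq hd hD hp hq hpq
  rw [h.length_eq_of_ne hd hD hp hq hpq, h.length_eq_of_ne hd hD hq hp hpq.symm, ← two_mul] at h2
  rw [h.length_eq_of_ne hd hD hp hq hpq] at h3
  rw [h.length_eq_of_ne hd hD hq hp hpq.symm] at h4
  exact ⟨e, h2, h3, h4⟩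

theorem IsCyclicSeq.forall_mem {e : ℤ → V} (he : IsCyclicSeq G e (2 * D)) (hD : 0 < D) {S : Set V}
    (h1 : ∀ i : ℕ, i ≤ D → e i ∈ S) (h2 : ∀ i : ℕ, i ≤ D → e (-i) ∈ S) (i : ℤ) : e i ∈ S := by
  obtain ⟨j, hj1, hj2, hij⟩ := he.exists_eq (by omega) (-D) i
  rw [hij]
  push_cast at hj2
  rcases le_total 0 j with hj | hj
  · have := h1 j.toNat (by omega)
    rwa [Int.toNat_of_nonneg hj] at this
  · have := h2 (-j).toNat (by omega)
    rwa [Int.toNat_of_nonneg (by omega), neg_neg] at this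

/-- An interior vertex of `p` has one antipode on the cycle `p`, `q` and one on the cycle `p`, `r`.
These differ, lying at opposite positions on the cycle `q`, `r`, and so exhaust its repeats. -/
theorem RepeatLaws.support_of_theta_interior (h : G.RepeatLaws d D) (hd : 4 ≤ d) (hD : 4 ≤ D)
    {a b : V} {p q r : G.Walk a b} (hp : p.Short D) (hq : q.Short D) (hr : r.Short D)
    (hpq : p ≠ q) (hpr : p ≠ r) (hqr : q ≠ r) {S : Set V} (sp : ∀ v ∈ p.support, v ∈ S)
    (sq : ∀ v ∈ q.support, v ∈ S) (sr : ∀ v ∈ r.support, v ∈ S) {k : ℕ} (hk : 0 < k) (hkD : k < D)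
    {x y : V} (hx : x = p.getVert k) (hR : G.Repeat D x y) (w : G.Walk x y) (hw : w.Short D) :
    ∀ v ∈ w.support, v ∈ S := by
  obtain ⟨e, he, e1, e2⟩ := h.exists_isCyclicSeq_two_mul hd hD hp hq hpq
  obtain ⟨f, hf, f1, f2⟩ := h.exists_isCyclicSeq_two_mul hd hD hp hr hpr
  obtain ⟨g, hg, g1, g2⟩ := h.exists_isCyclicSeq_two_mul hd hD hq hr hqr
  have heS : ∀ i, e i ∈ S := he.forall_mem (by omega)
    (fun i hi => e1 i hi ▸ sp _ (p.getVert_mem_support i))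
    (fun i hi => e2 i hi ▸ sq _ (q.getVert_mem_support i))
  have hfS : ∀ i, f i ∈ S := hf.forall_mem (by omega)
    (fun i hi => f1 i hi ▸ sp _ (p.getVert_mem_support i))
    (fun i hi => f2 i hi ▸ sr _ (r.getVert_mem_support i))
  have hek : e k = x := by rw [hx, e1 k hkD.le]
  have hfk : f k = e k := by rw [hek, hx, f1 k hkD.le]
  obtain rfl := hek
  obtain ⟨p₁, q₁, n₁, lp₁, lq₁, bp₁, bq₁, gp₁, gq₁⟩ :=
    he.exists_two_walks k (k + D) D D (by omega) rfl (by omega) (by omega)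
  obtain ⟨p₂, q₂, n₂, lp₂, lq₂, bp₂, bq₂, gp₂, gq₂⟩ :=
    hf.exists_two_walks k (k + D) D D (by omega) rfl (by omega) (by omega)
  have hne : e (k + D) ≠ f (k + D) := by
    have h1 : e (k + D) = g (D - k : ℕ) := by
      rw [g1 _ (by omega), ← e2 _ (by omega), ← he.per (-_)]
      congr 1
      omega
    have h2 : f (k + D) = g (-(D - k : ℕ)) := by
      rw [g2 _ (by omega), ← f2 _ (by omega), ← hf.per (-_)]
      congr 1
      omega
    rw [h1, h2]
    exact (hg.ne_of_lt h hd hD le_rfl (by omega) (by omega)).symm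
  refine h.support_of_two (p₁ := p₁) (q₁ := q₁) (p₂ := p₂.copy hfk rfl) (q₂ := q₂.copy hfk rfl)
    hne n₁ (fun hc => n₂ ?_) ⟨by omega, bp₁⟩ ⟨by omega, bq₁⟩ ⟨by simp [lp₂], bp₂.copy _ _⟩
    ⟨by simp [lq₂], bq₂.copy _ _⟩ ?_ ?_ ?_ ?_ hR w hw
  · exact Walk.ext_support (by simpa using congrArg Walk.support hc)
  · exact Walk.mem_of_getVert lp₁ gp₁ fun i _ => heS _
  · exact Walk.mem_of_getVert lq₁ gq₁ fun i _ => heS _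
  · rw [Walk.support_copy]
    exact Walk.mem_of_getVert lp₂ gp₂ fun i _ => hfS _
  · rw [Walk.support_copy]
    exact Walk.mem_of_getVert lq₂ gq₂ fun i _ => hfS _

/-- No vertex has a double repeat. -/
theorem RepeatLaws.not_three_short (h : G.RepeatLaws d D) (hd : 4 ≤ d) (hD : 4 ≤ D)
    {a b : V} {p q r : G.Walk a b} (hp : p.Short D) (hq : q.Short D) (hr : r.Short D)
    (hpq : p ≠ q) (hpr : p ≠ r) (hqr : q ≠ r) : False := by
  have lp := h.length_eq_of_ne hd hD hp hq hpq
  have lq := h.length_eq_of_ne hd hD hq hp hpq.symm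
  have lr := h.length_eq_of_ne hd hD hr hp hpr.symm
  set S : Set V := {v | v ∈ p.support ∨ v ∈ q.support ∨ v ∈ r.support}
  have sp : ∀ v ∈ p.support, v ∈ S := fun v hv => Or.inl hv
  have sq : ∀ v ∈ q.support, v ∈ S := fun v hv => Or.inr (Or.inl hv)
  have sr : ∀ v ∈ r.support, v ∈ S := fun v hv => Or.inr (Or.inr hv)
  have hS : IsSaturated G D S := by
    intro x hx y hR w hw
    by_cases hxa : x = a
    · subst hxa
      exact h.support_of_three hpq hpr hqr hp hq hr sp sq sr hR w hw
    by_cases hxb : x = b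
    · subst hxb
      refine h.support_of_three (p₁ := p.reverse) (p₂ := q.reverse) (p₃ := r.reverse)
        (fun h => hpq (Walk.reverse_injective h)) (fun h => hpr (Walk.reverse_injective h))
        (fun h => hqr (Walk.reverse_injective h)) hp.reverse hq.reverse hr.reverse ?_ ?_ ?_ hR w hw
      · simpa using sp
      · simpa using sq
      · simpa using sr
    have hpos : ∀ (p : G.Walk a b), p.length = D → x ∈ p.support →
        ∃ k, 0 < k ∧ k < D ∧ x = p.getVert k := by
      intro p hp hx
      obtain ⟨k, rfl, hk⟩ := Walk.mem_support_iff_exists_getVert.1 hx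
      refine ⟨k, Nat.pos_of_ne_zero ?_, lt_of_le_of_ne (hp ▸ hk) ?_, rfl⟩
      · rintro rfl
        exact hxa (by simp)
      · rintro rfl
        exact hxb (by rw [← hp]; simp)
    rcases hx with hx | hx | hx
    · obtain ⟨k, hk, hkD, hxk⟩ := hpos p lp hx
      exact h.support_of_theta_interior hd hD hp hq hr hpq hpr hqr sp sq sr hk hkD hxk hR w hw
    · obtain ⟨k, hk, hkD, hxk⟩ := hpos q lq hx
      exact h.support_of_theta_interior hd hD hq hp hr hpq.symm hqr hpr sq sp sr hk hkD hxk hR w hw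
    · obtain ⟨k, hk, hkD, hxk⟩ := hpos r lr hx
      exact h.support_of_theta_interior hd hD hr hp hq hpr.symm hqr.symm hpq sr sp sq hk hkD hxk
        hR w hw
  obtain ⟨e, he, e1, e2⟩ := h.exists_isCyclicSeq_two_mul hd hD hp hq hpq
  obtain ⟨f, hf, f1, f2⟩ := h.exists_isCyclicSeq_two_mul hd hD hp hr hpr
  obtain ⟨g, hg, g1, g2⟩ := h.exists_isCyclicSeq_two_mul hd hD hq hr hqr
  have hfS : ∀ i, f i ∈ S := hf.forall_mem (by omega)
    (fun i hi => f1 i hi ▸ sp _ (p.getVert_mem_support i))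
    (fun i hi => f2 i hi ▸ sr _ (r.getVert_mem_support i))
  have hgS : ∀ i, g i ∈ S := hg.forall_mem (by omega)
    (fun i hi => g1 i hi ▸ sq _ (q.getVert_mem_support i))
    (fun i hi => g2 i hi ▸ sr _ (r.getVert_mem_support i))
  have hef : ∀ i : ℕ, i ≤ D → f i = e i := fun i hi => (f1 i hi).trans (e1 i hi).symm
  have hge : ∀ i : ℕ, i ≤ D → g i = e (-i) := fun i hi => (g1 i hi).trans (e2 i hi).symm
  have hgf : ∀ i : ℕ, i ≤ D → g (-i) = f (-i) := fun i hi => (g2 i hi).trans (f2 i hi).symm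
  have hfe1 : f 1 = e 1 := by exact_mod_cast hef 1 (by omega)
  obtain ⟨u, hu, hus⟩ := by
    classical exact h.exists_nbr (f 1) {f 0, f 2} (lt_of_le_of_lt Finset.card_le_two (by omega))
  simp only [Finset.mem_insert, Finset.mem_singleton, not_or] at hus
  -- The cycles `e` and `f` share `p`, hence the vertices `f 0`, `f 1`, `f 2`, and together cover
  -- `S`. As neither has a chord, `u` lies outside `S`.
  have hchord : ∀ c : ℤ → V, IsCyclicSeq G c (2 * D) → (∀ i : ℕ, i ≤ D → c i = f i) →
      ∀ i, u ≠ c i := by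
    rintro c hc hcf i rfl
    obtain ⟨j, hj1, hj2, hij⟩ := hc.exists_eq (by omega) 1 i
    rw [hij] at hu hus
    have hc0 := hcf 0 (by omega)
    have hc1 := hcf 1 (by omega)
    have hc2 := hcf 2 (by omega)
    push_cast at hc0 hc1 hc2
    rw [← hc1] at hu
    rcases hc.eq_of_adj h hd hD le_rfl hj1 hj2 hu with h1 | h1
    · exact hus.2 (by rw [h1, ← hc2]; rfl)
    · refine hus.1 ?_
      rw [h1, ← hc0, ← hc.per 0]
      congr 1
      ring
  have huS : u ∉ S := by
    have hpos : ∀ (p : G.Walk a b), p.length = D → u ∈ p.support → ∃ k ≤ D, p.getVert k = u := by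
      intro p hp hx
      obtain ⟨k, rfl, hk⟩ := Walk.mem_support_iff_exists_getVert.1 hx
      exact ⟨k, hp ▸ hk, rfl⟩
    rintro (hx | hx | hx)
    · obtain ⟨k, hk, hxk⟩ := hpos p lp hx
      exact hchord f hf (fun _ _ => rfl) k (by rw [f1 k hk, hxk])
    · obtain ⟨k, hk, hxk⟩ := hpos q lq hx
      exact hchord e he (fun i hi => (hef i hi).symm) (-k) (by rw [e2 k hk, hxk])
    · obtain ⟨k, hk, hxk⟩ := hpos r lr hx
      exact hchord f hf (fun _ _ => rfl) (-k) (by rw [f2 k hk, hxk])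
  -- For `false_of_parallel`: x = p(1) has repeats y = q(D - 1) and z = r(D - 1), and t = r(1). The
  -- walk `σ` passes through `b`, `τ` through `a`, and `μ` runs along `r`.
  have hy : g (D - 1) = e (1 + D) := by
    have := hge (D - 1) (by omega)
    rw [Nat.cast_sub (by omega), Nat.cast_one] at this
    rw [this, ← he.per]
    congr 1
    push_cast
    ring
  have hz : g (1 - D) = f (1 + D) := by
    have := hgf (D - 1) (by omega)
    rw [Nat.cast_sub (by omega), Nat.cast_one, neg_sub] at this
    rw [this, ← hf.per]
    congr 1
    push_cast
    ring
  have ht : g (-1) = f (-1) := by exact_mod_cast hgf 1 (by omega)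
  have hxy : G.Repeat D (f 1) (g (D - 1)) := by
    rw [hy, hfe1]
    exact he.repeat_of 1 (1 + D) D D (by ring) rfl (by omega) (by omega) le_rfl le_rfl
  have hxz : G.Repeat D (f 1) (g (1 - D)) := by
    rw [hz]
    exact hf.repeat_of 1 (1 + D) D D (by ring) rfl (by omega) (by omega) le_rfl le_rfl
  have hyt : G.Repeat D (g (D - 1)) (f (-1)) := by
    rw [← ht]
    exact (hg.repeat_of (-1) (D - 1) D D (by ring) (by ring) (by omega) (by omega) le_rfl
      le_rfl).symm
  obtain ⟨σ, σ1, σ2, σ3⟩ := hg.exists_walk (D - 1) 2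
  obtain ⟨τ, τ1, τ2, τ3⟩ := hf.exists_walk (-1) 2
  obtain ⟨μ, μ1, μ2, μ3⟩ := hg.exists_walk (1 - D) (D - 2)
  have hσ : g (D - 1 + (2 : ℕ)) = g (1 - D) := by
    rw [← hg.per (1 - D)]; congr 1; push_cast; ring
  have hτ : f (-1 + (2 : ℕ)) = f 1 := by congr 1
  have hμ : g (1 - D + (D - 2 : ℕ)) = f (-1) := by rw [← ht]; congr 1; omega
  have sσ := Walk.mem_of_getVert (S := S) σ1 σ3 fun i _ => hgS _
  have sτ := Walk.mem_of_getVert (S := S) τ1 τ3 fun i _ => hfS _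
  have sμ := Walk.mem_of_getVert (S := S) μ1 μ3 fun i _ => hgS _
  exact hS.false_of_parallel h hd hD hxy hxz hyt (σ.copy rfl hσ) (σ2.copy _ _)
    (by simpa using sσ) (by simp [σ1]) (by simp [σ1]) (τ.copy rfl hτ).reverse
    (τ2.copy _ _).reverse (by simpa using sτ) (by simp [τ1]) (by simp [τ1]) (μ.copy rfl hμ)
    (μ2.copy _ _) (by simpa using sμ) (by simp [μ1]) hu huS

end SimpleGraph

/-! ### Cycles of length 2D as subgraphs. -/

namespace SimpleGraph

variable {V : Type*} {G : SimpleGraph V} {d D : ℕ}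

namespace IsCyclicSeq

variable {e : ℤ → V} {L : ℕ}

/-- The subgraph traced out by a cyclic sequence. -/
def subgraph (he : IsCyclicSeq G e L) : G.Subgraph where
  verts := Set.range e
  Adj u v := ∃ i, s(e i, e (i + 1)) = s(u, v)
  adj_sub := by
    rintro u v ⟨i, hi⟩
    rw [← mem_edgeSet, ← hi]
    exact he.adj i
  edge_vert := by
    rintro u v ⟨i, hi⟩
    rw [Sym2.eq_iff] at hi
    rcases hi with ⟨h, -⟩ | ⟨-, h⟩
    · exact ⟨_, h⟩
    · exact ⟨_, h⟩
  symm := ⟨by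
    rintro u v ⟨i, hi⟩
    exact ⟨i, hi.trans Sym2.eq_swap⟩⟩

theorem toSubgraph_eq (he : IsCyclicSeq G e L) (hL : 0 < L) {x : V} {c : G.Walk x x}
    (hc : c.length = L) (hce : ∀ i ≤ L, c.getVert i = e i) : c.toSubgraph = he.subgraph := by
  have hred : ∀ i : ℤ, ∃ j : ℕ, j < L ∧ e i = e j ∧ e (i + 1) = e (j + 1) := by
    intro i
    refine ⟨(i % L).toNat, ?_, ?_⟩
    · have := Int.emod_lt_of_pos i (b := L) (by omega)
      omega
    · have h1 := Int.emod_add_mul_ediv i L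
      have h2 := Int.emod_nonneg i (b := L) (by omega)
      rw [Int.toNat_of_nonneg h2, ← he.per_mul (i % L) (i / L),
        ← he.per_mul (i % L + 1) (i / L)]
      constructor
      · congr 1
        linarith [mul_comm (L : ℤ) (i / L)]
      · congr 1
        linarith [mul_comm (L : ℤ) (i / L)]
  ext u v
  · rw [Walk.mem_verts_toSubgraph]
    constructor
    · intro hu
      obtain ⟨n, rfl, hn⟩ := Walk.mem_support_iff_exists_getVert.1 hu
      exact ⟨n, (hce n (hc ▸ hn)).symm⟩
    · rintro ⟨i, rfl⟩
      obtain ⟨j, hj, h1, -⟩ := hred i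
      rw [h1, ← hce j hj.le]
      exact c.getVert_mem_support j
  · rw [Walk.toSubgraph_adj_iff]
    constructor
    · rintro ⟨i, hi, hlt⟩
      refine ⟨i, ?_⟩
      rw [← hi, hce i (by omega), hce (i + 1) (by omega)]
      push_cast
      rfl
    · rintro ⟨i, hi⟩
      obtain ⟨j, hj, h1, h2⟩ := hred i
      refine ⟨j, ?_, by omega⟩
      rw [← hi, h1, h2, hce j (by omega), hce (j + 1) (by omega)]
      push_cast
      rfl

theorem subgraph_refl_at (he : IsCyclicSeq G e L) (c : ℤ) :
    (he.refl_at c).subgraph = he.subgraph := by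
  ext u v
  · constructor
    · rintro ⟨i, rfl⟩
      exact ⟨_, rfl⟩
    · rintro ⟨i, rfl⟩
      exact ⟨c - i, by simp⟩
  · constructor
    · rintro ⟨i, hi⟩
      refine ⟨c - (i + 1), ?_⟩
      rw [← hi, show c - (i + 1) + 1 = c - i by ring]
      exact Sym2.eq_swap
    · rintro ⟨i, hi⟩
      refine ⟨c - (i + 1), ?_⟩
      dsimp only
      rw [← hi, show c - (c - (i + 1)) = i + 1 by ring, show c - (c - (i + 1) + 1) = i by ring]
      exact Sym2.eq_swap

theorem isCycleOfLength_subgraph (he : IsCyclicSeq G e (2 * D)) (h : G.RepeatLaws d D)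
    (hd : 4 ≤ d) (hD : 4 ≤ D) : he.subgraph.IsCycleOfLength (2 * D) := by
  obtain ⟨p, p1, -, p3⟩ := he.exists_walk 0 (2 * D)
  have hend : e (0 + (2 * D : ℕ)) = e 0 := he.per 0
  have hg : ∀ i ≤ 2 * D, (p.copy rfl hend).getVert i = e i := by
    intro i hi
    rw [Walk.getVert_copy, p3 i hi, zero_add]
  have hl : (p.copy rfl hend).length = 2 * D := by simpa using p1
  generalize p.copy rfl hend = c at hg hl
  refine ⟨e 0, c, ?_, hl, (he.toSubgraph_eq (by omega) hl hg).symm⟩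
  rw [Walk.isCycle_iff_isPath_tail_and_le_length]
  refine ⟨?_, by omega⟩
  rw [← Walk.IsPath.getVert_injOn_iff]
  have htl : c.tail.length = 2 * D - 1 := by
    have : ¬ c.Nil := by rw [← Walk.length_eq_zero_iff]; omega
    have := Walk.length_tail_add_one this
    omega
  intro i hi j hj hij
  simp only [Set.mem_ofPred_eq, htl] at hi hj
  rw [Walk.getVert_tail, Walk.getVert_tail, hg _ (by omega), hg _ (by omega)] at hij
  rcases lt_trichotomy i j with h1 | h1 | h1
  · exact (he.ne_of_lt h hd hD le_rfl (by push_cast; omega) (by push_cast; omega) hij).elim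
  · exact h1
  · exact (he.ne_of_lt h hd hD le_rfl (by push_cast; omega) (by push_cast; omega) hij.symm).elim

end IsCyclicSeq

theorem Walk.NB.take {x y : V} {p : G.Walk x y} (hp : p.NB) (n : ℕ) : (p.take n).NB := by
  rw [Walk.nb_iff_getVert] at *
  intro i hi
  rw [Walk.take_length] at hi
  rw [Walk.take_getVert, Walk.take_getVert, min_eq_right (by omega), min_eq_right (by omega)]
  exact hp i (by omega)

theorem Walk.NB.drop {x y : V} {p : G.Walk x y} (hp : p.NB) (n : ℕ) : (p.drop n).NB := by
  rw [Walk.nb_iff_getVert] at *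
  intro i hi
  rw [Walk.drop_length] at hi
  rw [Walk.drop_getVert, Walk.drop_getVert, ← add_assoc]
  exact hp _ (by omega)

theorem Walk.IsCycle.nb {x : V} {c : G.Walk x x} (hc : c.IsCycle) : c.NB := by
  rw [Walk.nb_iff_getVert]
  intro i hi h
  have h3 := hc.three_le_length
  have hinj := hc.getVert_injOn
  by_cases h0 : i = 0
  · subst h0
    have h1 : c.getVert c.length = c.getVert 2 := by simpa using h
    have := hinj (by simp; omega) (by simp; omega) h1
    omega
  · have := hinj (by simp; omega) (by simp; omega) h
    omega

/-- A cycle of length at most `2D` has length `2D` and splits into two short walks. -/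
theorem RepeatLaws.split_cycle (h : G.RepeatLaws d D) (hd : 4 ≤ d) (hD : 4 ≤ D) {x : V}
    {c : G.Walk x x} (hc : c.IsCycle) (hlen : c.length ≤ 2 * D) :
    c.length = 2 * D ∧ c.take D ≠ (c.drop D).reverse ∧ (c.take D).Short D ∧
      (c.drop D).reverse.Short D := by
  have h3 := hc.three_le_length
  have hnb := hc.nb
  have key : ∀ a, 1 ≤ a → a + 1 ≤ c.length → c.take a ≠ (c.drop a).reverse := by
    intro a ha ha' heq
    have h1 : (c.take a).getVert 1 = c.getVert 1 := by
      rw [Walk.take_getVert, min_eq_right ha]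
    have h2 : (c.drop a).reverse.getVert 1 = c.getVert (c.length - 1) := by
      rw [Walk.getVert_reverse, Walk.drop_getVert, Walk.drop_length]
      congr 1
      omega
    rw [heq, h2] at h1
    have := hc.getVert_injOn (by simp; omega) (by simp; omega) h1
    omega
  have hs : ∀ a ≤ D, c.length ≤ a + D → (c.take a).Short D ∧ (c.drop a).reverse.Short D :=
    fun a ha ha' => ⟨⟨by rw [Walk.take_length]; omega, hnb.take a⟩,
      ⟨by rw [Walk.length_reverse, Walk.drop_length]; omega, (hnb.drop a).reverse⟩⟩
  have hl : c.length = 2 * D := by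
    -- The cut must leave both pieces nonempty and of length at most `D`, even before the length of
    -- `c` is known.
    set a := min D (c.length - 1) with ha
    obtain ⟨s1, s2⟩ := hs a (by omega) (by omega)
    have hne := key a (by omega) (by omega)
    have l1 := h.length_eq_of_ne hd hD s1 s2 hne
    have l2 := h.length_eq_of_ne hd hD s2 s1 hne.symm
    rw [Walk.take_length] at l1
    rw [Walk.length_reverse, Walk.drop_length] at l2
    omega
  exact ⟨hl, key D (by omega) (by omega), hs D le_rfl (by omega)⟩

/-- A cycle through `x` is determined by the antipode of `x`: its halves are two different short
walks to `y`, and there is no third besides `p` and `q`. -/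
theorem RepeatLaws.toSubgraph_cycle_eq (h : G.RepeatLaws d D) (hd : 4 ≤ d) (hD : 4 ≤ D) {x y : V}
    {p q : G.Walk x y} (hp : p.Short D) (hq : q.Short D) (hpq : p ≠ q) {e : ℤ → V}
    (he : IsCyclicSeq G e (2 * D)) (e1 : ∀ i : ℕ, i ≤ D → e i = p.getVert i)
    (e2 : ∀ i : ℕ, i ≤ D → e (-i) = q.getVert i) {c : G.Walk x x} (hc : c.IsCycle)
    (hlen : c.length ≤ 2 * D) (hy : c.getVert D = y) : c.toSubgraph = he.subgraph := by
  subst hy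
  obtain ⟨hl, hne, s1, s2⟩ := h.split_cycle hd hD hc hlen
  have key : ∀ r : G.Walk x (c.getVert D), r.Short D → r = p ∨ r = q := by
    intro r hr
    by_contra hcon
    push Not at hcon
    exact h.not_three_short hd hD hr hp hq hcon.1 hcon.2 hpq
  have hfin : ∀ (f : ℤ → V) (hf : IsCyclicSeq G f (2 * D)),
      (∀ i : ℕ, i ≤ D → f i = (c.take D).getVert i) →
      (∀ i : ℕ, i ≤ D → f (-i) = (c.drop D).reverse.getVert i) → c.toSubgraph = hf.subgraph := by
    intro f hf f1 f2
    refine hf.toSubgraph_eq (by omega) hl fun i hi => ?_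
    by_cases hiD : i ≤ D
    · rw [f1 i hiD, Walk.take_getVert, min_eq_right hiD]
    · have h1 := f2 (2 * D - i) (by omega)
      rw [Walk.getVert_reverse, Walk.drop_length, Walk.drop_getVert,
        show D + (c.length - D - (2 * D - i)) = i by omega] at h1
      rw [← h1, ← hf.per (-_)]
      congr 1
      omega
  rcases key _ s1 with h1 | h1 <;> rcases key _ s2 with h2 | h2
  · exact (hne (h1.trans h2.symm)).elim
  · exact hfin e he (h1 ▸ e1) (h2 ▸ e2)
  · rw [← he.subgraph_refl_at 0]
    refine hfin _ (he.refl_at 0) (fun i hi => ?_) (fun i hi => ?_)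
    · rw [h1, zero_sub, e2 i hi]
    · rw [h2, zero_sub, neg_neg, e1 i hi]
  · exact (hne (h1.trans h2.symm)).elim

/-! ### The intersection of two 2D-cycles through a vertex. -/

section Intersection

variable {e f : ℤ → V}

/-- Different short walks with common ends both have length `D`. That would force m = n = D,
contrary to `hne`, so the two initial segments are the same walk. -/
theorem IsCyclicSeq.eq_of_eq_nat (he : IsCyclicSeq G e (2 * D)) (hf : IsCyclicSeq G f (2 * D))
    (h : G.RepeatLaws d D) (hd : 4 ≤ d) (hD : 4 ≤ D) (h0 : e 0 = f 0) (hne : e D ≠ f D)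
    {m n : ℕ} (hm : m ≤ D) (hn : n ≤ D) (hmn : e m = f n) :
    m < D ∧ ∀ k ≤ m, e k = f k := by
  obtain ⟨p, p1, p2, p3⟩ := he.exists_walk 0 m
  obtain ⟨q, q1, q2, q3⟩ := hf.exists_walk 0 n
  have hend : f (0 + n) = e (0 + m) := by rw [zero_add, zero_add, hmn]
  have hq : (q.copy h0.symm hend).Short D := ⟨by rw [Walk.length_copy]; omega, q2.copy _ _⟩
  have hp : p.Short D := ⟨by omega, p2⟩
  have hneD : ¬ (m = D ∧ n = D) := by
    rintro ⟨rfl, rfl⟩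
    exact hne hmn
  by_cases hpq : p = q.copy h0.symm hend
  · have hl := congrArg Walk.length hpq
    rw [Walk.length_copy] at hl
    refine ⟨by omega, fun k hk => ?_⟩
    have h1 := p3 k hk
    rw [hpq, Walk.getVert_copy, q3 k (by omega)] at h1
    simpa using h1.symm
  · have l1 := h.length_eq_of_ne hd hD hp hq hpq
    have l2 := h.length_eq_of_ne hd hD hq hp (Ne.symm hpq)
    rw [Walk.length_copy] at l2
    exact (hneD ⟨by omega, by omega⟩).elim

/-- Every common vertex of the two cycles is reached from `e 0` along a common segment. -/
def IsAligned (D : ℕ) (e f : ℤ → V) : Prop :=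
  ∀ i j : ℤ, -D ≤ i → i ≤ D → e i = f j →
    -D < i ∧ i < D ∧ ∀ k, (0 ≤ k ∧ k ≤ i ∨ i ≤ k ∧ k ≤ 0) → e k = f k

/-- Each common vertex makes `f` run along `e` in the same or the opposite direction. Two common
vertices other than `e 0` cannot disagree, since one of the sequences would then backtrack at 0. -/
theorem IsCyclicSeq.isAligned_or (he : IsCyclicSeq G e (2 * D)) (hf : IsCyclicSeq G f (2 * D))
    (h : G.RepeatLaws d D) (hd : 4 ≤ d) (hD : 4 ≤ D) (h0 : e 0 = f 0) (hne : e D ≠ f D) :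
    IsAligned D e f ∨ IsAligned D e (fun i => f (0 - i)) := by
  have heD : e (-D) = e D := by
    rw [← he.per (-D)]; congr 1; push_cast; ring
  have hfD : f (-D) = f D := by
    rw [← hf.per (-D)]; congr 1; push_cast; ring
  have hpos : ∀ (c g : ℤ → V), IsCyclicSeq G c (2 * D) → IsCyclicSeq G g (2 * D) → c 0 = g 0 →
      c D ≠ g D → ∀ i j : ℤ, 0 ≤ i → i ≤ D → 0 ≤ j → j ≤ D → c i = g j →
      i < D ∧ ∀ k, 0 ≤ k → k ≤ i → c k = g k := by
    intro c g hc hg hcg hcgD i j hi hi' hj hj' hij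
    have := hc.eq_of_eq_nat hg h hd hD hcg hcgD (m := i.toNat) (n := j.toNat) (by omega) (by omega)
      (by rwa [Int.toNat_of_nonneg hi, Int.toNat_of_nonneg hj])
    refine ⟨by omega, fun k hk hki => ?_⟩
    have h2 := this.2 k.toNat (by omega)
    rwa [Int.toNat_of_nonneg hk] at h2
  have hcase : ∀ i j : ℤ, -D ≤ i → i ≤ D → e i = f j → (-D < i ∧ i < D) ∧
      ((∀ k, (0 ≤ k ∧ k ≤ i ∨ i ≤ k ∧ k ≤ 0) → e k = f k) ∨
        ∀ k, (0 ≤ k ∧ k ≤ i ∨ i ≤ k ∧ k ≤ 0) → e k = f (0 - k)) := by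
    intro i j' hi hi' hij'
    obtain ⟨j, hj, hj', hjj⟩ := hf.exists_eq (by omega) (-D) j'
    push_cast at hj'
    have hij : e i = f j := hij'.trans hjj
    rcases le_total 0 i with hi0 | hi0 <;> rcases le_total 0 j with hj0 | hj0
    · obtain ⟨h1, h2⟩ := hpos e f he hf h0 hne i j hi0 hi' hj0 (by omega) hij
      exact ⟨⟨by omega, h1⟩, Or.inl fun k hk => h2 k (by omega) (by omega)⟩
    · obtain ⟨h1, h2⟩ := hpos e _ he (hf.refl_at 0) (by simpa using h0)
        (by simpa [hfD] using hne) i (-j) hi0 hi' (by omega) (by omega) (by simpa using hij)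
      exact ⟨⟨by omega, h1⟩, Or.inr fun k hk => h2 k (by omega) (by omega)⟩
    · obtain ⟨h1, h2⟩ := hpos _ f (he.refl_at 0) hf (by simpa using h0)
        (by simpa [heD] using hne) (-i) j (by omega) (by omega) hj0 (by omega) (by simpa using hij)
      refine ⟨⟨by omega, by omega⟩, Or.inr fun k hk => ?_⟩
      have := h2 (-k) (by omega) (by omega)
      simpa using this
    · obtain ⟨h1, h2⟩ := hpos _ _ (he.refl_at 0) (hf.refl_at 0) (by simpa using h0)
        (by simpa [heD, hfD] using hne) (-i) (-j) (by omega) (by omega) (by omega) (by omega)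
        (by simpa using hij)
      refine ⟨⟨by omega, by omega⟩, Or.inl fun k hk => ?_⟩
      have := h2 (-k) (by omega) (by omega)
      simpa using this
  have heN : e (-1) ≠ e 1 := he.nb (-1)
  have hfN : f (-1) ≠ f 1 := hf.nb (-1)
  by_cases hex : ∃ i j : ℤ, i ≠ 0 ∧ -D ≤ i ∧ i ≤ D ∧ e i = f j ∧
      ∀ k, (0 ≤ k ∧ k ≤ i ∨ i ≤ k ∧ k ≤ 0) → e k = f (0 - k)
  · right
    obtain ⟨i₀, -, hi₀, -, -, -, hk₀⟩ := hex
    have hone : e 1 = f (-1) ∨ e (-1) = f 1 := by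
      rcases lt_or_gt_of_ne hi₀ with hlt | hlt
      · exact Or.inr (by simpa using hk₀ (-1) (by omega))
      · exact Or.inl (by simpa using hk₀ 1 (by omega))
    intro i j hi hi' hij
    obtain ⟨⟨h1, h2⟩, h3 | h3⟩ := hcase i (0 - j) hi hi' hij
    · refine ⟨h1, h2, ?_⟩
      have : i = 0 := by
        by_contra hi0
        rcases lt_or_gt_of_ne hi0 with hlt | hlt
        · have h4 := h3 (-1) (by omega)
          rcases hone with h5 | h5
          · exact heN (h4.trans h5.symm)
          · exact hfN (h4.symm.trans h5)
        · have h4 := h3 1 (by omega)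
          rcases hone with h5 | h5
          · exact hfN (h5.symm.trans h4)
          · exact heN (h5.trans h4.symm)
      intro k hk
      obtain rfl : k = 0 := by omega
      simpa using h0
    · exact ⟨h1, h2, h3⟩
  · left
    intro i j hi hi' hij
    obtain ⟨⟨h1, h2⟩, h3 | h3⟩ := hcase i j hi hi' hij
    · exact ⟨h1, h2, h3⟩
    · refine ⟨h1, h2, fun k hk => ?_⟩
      have : i = 0 := by
        by_contra hi0
        exact hex ⟨i, j, hi0, hi, hi', hij, h3⟩
      obtain rfl : k = 0 := by omega
      exact h0

/-- Alignment puts all common vertices on one segment, from the last agreement backwards (-b) to the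
last one forwards (a). -/
theorem IsCyclicSeq.inf_isPathOfLength_of_isAligned (he : IsCyclicSeq G e (2 * D))
    (hf : IsCyclicSeq G f (2 * D)) (h : G.RepeatLaws d D) (hd : 4 ≤ d) (hD : 4 ≤ D)
    (h0 : e 0 = f 0) (hne : e D ≠ f D) (hal : IsAligned D e f) :
    ∃ l : ℕ, l ≤ D - 1 ∧ (he.subgraph ⊓ hf.subgraph).IsPathOfLength l := by
  classical
  obtain ⟨a, haD, ha, ha'⟩ : ∃ a : ℕ, a ≤ D ∧ e a = f a ∧ ∀ n : ℕ, n ≤ D → e n = f n → n ≤ a :=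
    ⟨Nat.findGreatest (fun n : ℕ => e n = f n) D, Nat.findGreatest_le D,
      Nat.findGreatest_spec (P := fun n : ℕ => e n = f n) (Nat.zero_le D) h0,
      fun n hn h => Nat.le_findGreatest hn h⟩
  obtain ⟨b, hbD, hb, hb'⟩ : ∃ b : ℕ, b ≤ D ∧ e (-b) = f (-b) ∧
      ∀ n : ℕ, n ≤ D → e (-n) = f (-n) → n ≤ b :=
    ⟨Nat.findGreatest (fun n : ℕ => e (-n) = f (-n)) D, Nat.findGreatest_le D,
      Nat.findGreatest_spec (P := fun n : ℕ => e (-n) = f (-n)) (Nat.zero_le D) (by simpa using h0),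
      fun n hn h => Nat.le_findGreatest hn h⟩
  obtain ⟨-, haD', hak⟩ := hal a a (by omega) (by omega) ha
  obtain ⟨hbD', -, hbk⟩ := hal (-b) (-b) (by omega) (by omega) hb
  have hcommon : ∀ k : ℤ, -b ≤ k → k ≤ a → e k = f k := by
    intro k hk hk'
    rcases le_total 0 k with h1 | h1
    · exact hak k (Or.inl ⟨h1, hk'⟩)
    · exact hbk k (Or.inr ⟨hk, h1⟩)
  have hrange : ∀ i j : ℤ, -D ≤ i → i ≤ D → e i = f j → -b ≤ i ∧ i ≤ a := by
    intro i j hi hi' hij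
    obtain ⟨-, -, h3⟩ := hal i j hi hi' hij
    rcases le_total 0 i with h1 | h1
    · have h4 := ha' i.toNat (by omega)
        (by rw [Int.toNat_of_nonneg h1]; exact h3 i (by omega))
      omega
    · have h4 := hb' (-i).toNat (by omega)
        (by rw [Int.toNat_of_nonneg (by omega), neg_neg]; exact h3 i (by omega))
      omega
  have heD : e (-D) = e D := by
    rw [← he.per (-D)]; congr 1; push_cast; ring
  have hfD : f (-D) = f D := by
    rw [← hf.per (-D)]; congr 1; push_cast; ring
  -- If the segment had length at least `D`, both halves of `e` between -b and -b + D, and the half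
  -- of `f` running backwards, would be three short walks with the same ends.
  have hab : a + b ≤ D - 1 := by
    by_contra hlt
    obtain ⟨p, q, pq, p1, q1, p2, q2, p3, q3⟩ :=
      he.exists_two_walks (-b) (-b + D) D D (by ring) rfl (by omega) (by omega)
    obtain ⟨r, s, -, -, s1, -, s2, -, s3⟩ :=
      hf.exists_two_walks (-b) (-b + D) D D (by ring) rfl (by omega) (by omega)
    have hend : f (-b + D) = e (-b + D) := (hcommon _ (by omega) (by omega)).symm
    refine h.not_three_short hd hD (p := p) (q := q) (r := s.copy hb.symm hend)
      ⟨by omega, p2⟩ ⟨by omega, q2⟩ ⟨by rw [Walk.length_copy]; omega, s2.copy _ _⟩ pq ?_ ?_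
    · intro hps
      have h1 := p3 1 (by omega)
      rw [hps, Walk.getVert_copy, s3 1 (by omega), hcommon _ (by omega) (by omega)] at h1
      have h2 := hf.nb (-b - 1)
      rw [show (-b - 1 + 2 : ℤ) = -b + 1 by ring] at h2
      exact h2 (by simpa using h1)
    · intro hqs
      have h1 := q3 (D - b) (by omega)
      rw [hqs, Walk.getVert_copy, s3 _ (by omega),
        show (-b - (D - b : ℕ) : ℤ) = -D by omega, heD, hfD] at h1
      exact hne h1.symm
  obtain ⟨p, p1, -, p3⟩ := he.exists_walk (-b) (a + b)
  refine ⟨a + b, hab, _, _, p, ?_, p1, ?_⟩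
  · rw [← Walk.IsPath.getVert_injOn_iff]
    intro i hi j hj hij
    simp only [Set.mem_ofPred_eq, p1] at hi hj
    rw [p3 i hi, p3 j hj] at hij
    rcases lt_trichotomy i j with h1 | h1 | h1
    · exact (he.ne_of_lt h hd hD le_rfl (by omega) (by push_cast; omega) hij).elim
    · exact h1
    · exact (he.ne_of_lt h hd hD le_rfl (by omega) (by push_cast; omega) hij.symm).elim
  · ext u v
    · rw [Walk.mem_verts_toSubgraph, Walk.mem_support_iff_exists_getVert, Subgraph.verts_inf]
      constructor
      · rintro ⟨⟨i', rfl⟩, ⟨j, hj⟩⟩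
        obtain ⟨i, hi, hi', hii⟩ := he.exists_eq (by omega) (-D) i'
        push_cast at hi'
        rw [hii] at hj ⊢
        obtain ⟨h1, h2⟩ := hrange i j hi (by omega) hj.symm
        refine ⟨(i + b).toNat, ?_, by omega⟩
        rw [p3 _ (by omega)]
        congr 1
        omega
      · rintro ⟨n, rfl, hn⟩
        rw [p3 n (by omega)]
        exact ⟨⟨_, rfl⟩, ⟨-b + n, (hcommon _ (by omega) (by omega)).symm⟩⟩
    · rw [Walk.toSubgraph_adj_iff, Subgraph.inf_adj]
      constructor
      · rintro ⟨⟨i', hi'⟩, hF⟩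
        have hu := hf.subgraph.edge_vert hF
        have hv := hf.subgraph.edge_vert hF.symm
        obtain ⟨i, hi, hiD, hii, hii'⟩ : ∃ i : ℤ, -D ≤ i ∧ i < D ∧ e i' = e i ∧
            e (i' + 1) = e (i + 1) := by
          have h1 := Int.emod_nonneg (i' + D) (b := (2 * D : ℕ)) (by omega)
          have h2 := Int.emod_lt_of_pos (i' + D) (b := (2 * D : ℕ)) (by omega)
          have h3 := Int.emod_add_mul_ediv (i' + D) (2 * D : ℕ)
          have h4 := mul_comm ((2 * D : ℕ) : ℤ) ((i' + D) / (2 * D : ℕ))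
          refine ⟨-D + (i' + D) % (2 * D : ℕ), by omega, by push_cast at h2 ⊢; omega, ?_, ?_⟩
          · rw [← he.per_mul (-D + _) ((i' + D) / (2 * D : ℕ))]
            congr 1
            linarith
          · rw [← he.per_mul (-D + _ + 1) ((i' + D) / (2 * D : ℕ))]
            congr 1
            linarith
        rw [hii, hii'] at hi'
        have hmem : e i ∈ Set.range f ∧ e (i + 1) ∈ Set.range f := by
          rw [Sym2.eq_iff] at hi'
          rcases hi' with ⟨h1, h2⟩ | ⟨h1, h2⟩
          · rw [h1, h2]; exact ⟨hu, hv⟩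
          · rw [h1, h2]; exact ⟨hv, hu⟩
        obtain ⟨⟨j, hj⟩, ⟨j', hj'⟩⟩ := hmem
        have h1 := hrange i j hi hiD.le hj.symm
        have h2 := hrange (i + 1) j' (by omega) (by omega) hj'.symm
        refine ⟨(i + b).toNat, ?_, by omega⟩
        rw [p3 _ (by omega), p3 _ (by omega), ← hi',
          show (-b + (i + b).toNat : ℤ) = i by omega,
          show (-b + ((i + b).toNat + 1 : ℕ) : ℤ) = i + 1 by omega]
      · rintro ⟨n, hn, hn'⟩
        rw [p3 n (by omega), p3 (n + 1) (by omega)] at hn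
        push_cast at hn
        rw [← add_assoc] at hn
        refine ⟨⟨-b + n, hn⟩, ⟨-b + n, ?_⟩⟩
        rw [← hcommon _ (by omega) (by omega), ← hcommon _ (by omega) (by omega), hn]

theorem IsCyclicSeq.inf_isPathOfLength (he : IsCyclicSeq G e (2 * D))
    (hf : IsCyclicSeq G f (2 * D)) (h : G.RepeatLaws d D) (hd : 4 ≤ d) (hD : 4 ≤ D)
    (h0 : e 0 = f 0) (hne : e D ≠ f D) :
    ∃ l : ℕ, l ≤ D - 1 ∧ (he.subgraph ⊓ hf.subgraph).IsPathOfLength l := by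
  rcases he.isAligned_or hf h hd hD h0 hne with hal | hal
  · exact he.inf_isPathOfLength_of_isAligned hf h hd hD h0 hne hal
  · rw [← hf.subgraph_refl_at 0]
    refine he.inf_isPathOfLength_of_isAligned (hf.refl_at 0) h hd hD (by simpa using h0) ?_ hal
    have hfD : f (-D) = f D := by
      rw [← hf.per (-D)]; congr 1; push_cast; ring
    simpa [hfD] using hne

end Intersection

/-! ### The two conclusions. -/

theorem RepeatLaws.not_isTheta (h : G.RepeatLaws d D) (hd : 4 ≤ d) (hD : 4 ≤ D) (H : G.Subgraph) :
    ¬ H.IsTheta D := by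
  rintro ⟨a, b, p, -, hp, hdist, -⟩
  have hs : ∀ i, (p i).Short D := fun i => ⟨(hp i).2.le, (hp i).1.nb⟩
  exact h.not_three_short hd hD (hs 0) (hs 1) (hs 2) (hdist 0 1 (by decide)).1
    (hdist 0 2 (by decide)).1 (hdist 1 2 (by decide)).1

/-- With triple short walks excluded, `x` has two repeats `y` and `z`, each spanning one 2D-cycle
with `x`. Any further cycle of length at most 2D has a repeat of `x` opposite `x`, hence `y` or `z`.
-/
theorem RepeatLaws.isTypeThree (h : G.RepeatLaws d D) (hd : 4 ≤ d) (hD : 4 ≤ D) (x : V) :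
    IsTypeThree G D x := by
  classical
  obtain ⟨y, z, hyz, ⟨p, q, hpq, hp, hq⟩, ⟨r, s, hrs, hr, hs⟩⟩ |
    ⟨y, p, q, r, hp, hq, hr, hpq, hpr, hqr⟩ := h.exists_repeat x
  swap
  · exact (h.not_three_short hd hD hp hq hr hpq hpr hqr).elim
  have lp := h.length_eq_of_ne hd hD hp hq hpq
  have lr := h.length_eq_of_ne hd hD hr hs hrs
  obtain ⟨e, he, e1, e2⟩ := h.exists_isCyclicSeq_two_mul hd hD hp hq hpq
  obtain ⟨f, hf, f1, f2⟩ := h.exists_isCyclicSeq_two_mul hd hD hr hs hrs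
  have he0 : e 0 = x := by simpa using e1 0 (Nat.zero_le D)
  have hf0 : f 0 = x := by simpa using f1 0 (Nat.zero_le D)
  have heD : e D = y := by rw [e1 D le_rfl, ← lp, Walk.getVert_length]
  have hfD : f D = z := by rw [f1 D le_rfl, ← lr, Walk.getVert_length]
  have h0 : e 0 = f 0 := he0.trans hf0.symm
  have hne : e D ≠ f D := by rwa [heD, hfD]
  refine ⟨he.subgraph, hf.subgraph, ?_, he.isCycleOfLength_subgraph h hd hD, ⟨0, he0⟩,
    hf.isCycleOfLength_subgraph h hd hD, ⟨0, hf0⟩, he.inf_isPathOfLength hf h hd hD h0 hne, ?_⟩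
  -- Alignment keeps every common vertex strictly between the positions -D and D of `e`, so `e D` is
  -- not on `f`.
  · intro heq
    obtain ⟨j, hj⟩ : e D ∈ Set.range f := by
      have h1 : e D ∈ he.subgraph.verts := ⟨_, rfl⟩
      rw [heq] at h1
      exact h1
    rcases he.isAligned_or hf h hd hD h0 hne with hal | hal
    · exact (hal D j (by omega) le_rfl hj.symm).2.1.false
    · exact (hal D (-j) (by omega) le_rfl (by simpa using hj.symm)).2.1.false
  · rintro C k hk ⟨u, c, hc, rfl, rfl⟩ hx
    rw [Walk.mem_verts_toSubgraph] at hx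
    rw [← Walk.toSubgraph_rotate c hx]
    have hc' := hc.rotate hx
    have hl : (c.rotate x hx).length ≤ 2 * D := by simpa using hk
    obtain ⟨-, hne', s1, s2⟩ := h.split_cycle hd hD hc' hl
    by_cases hy : (c.rotate x hx).getVert D = y
    · exact Or.inl (h.toSubgraph_cycle_eq hd hD hp hq hpq he e1 e2 hc' hl hy)
    by_cases hz : (c.rotate x hx).getVert D = z
    · exact Or.inr (h.toSubgraph_cycle_eq hd hD hr hs hrs hf f1 f2 hc' hl hz)
    exact (h.not_three x y z _ hyz (Ne.symm hy) (Ne.symm hz) ⟨p, q, hpq, hp, hq⟩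
      ⟨r, s, hrs, hr, hs⟩ ⟨_, _, hne', s1, s2⟩).elim

end SimpleGraph

theorem mainTheorem6 {V : Type*} [Fintype V] (G : SimpleGraph V) [DecidableRel G.Adj]
    (d D : ℕ) (hd : 4 ≤ d) (hD : 4 ≤ D) (hG : IsDefectGraph G d D 2) :
    (∀ H : G.Subgraph, ¬ H.IsTheta D) ∧ (∀ x : V, IsTypeThree G D x) :=
  have h := SimpleGraph.repeatLaws_of_isDefectGraph hd hD hG
  ⟨h.not_isTheta hd hD, h.isTypeThree hd hD⟩
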